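/- Let $(M^n,g,J)$ be a smooth almost Hermitian manifold: $g$ is a Riemannian metric and $J$ an almost complex structure ($J^2=-\mathrm{Id}$) with $g(JX,JY)=g(X,Y)$. Let $\omega(X,Y)=g(JX,Y)$, let $D$ be the Levi-Civita connection of $g$, and let $\nabla$ be the Chern connection, i.e. the unique connection with $\nabla g=0$, $\nabla J=0$ and $\tau^{1,1}=0$, where $\tau$ is its torsion and $\tau^{1,1}(X,Y)=\tfrac12\big(\tau(X,Y)+\tau(JX,JY)\big)$. Work in local coordinates, or more generally in a smooth local frame $(e_i)$ of $TM$, with summation over repeated indices. Write $Je_i=J_i^a e_a$; let $(g^{ij})$ and $(\omega^{ij})$ be the inverse matrices of $(g_{ij})$ and $(\omega_{ij})$, with $g^{ac}g_{cb}=\omega^{ac}\omega_{cb}=\delta^a_b$. Define * the Lee form $\vartheta_k=\tfrac12\,\omega^{ji}(d\omega)_{ijk}$, where in coordinates $(d\omega)_{ijk}=\partial_i\omega_{jk}+\partial_j\omega_{ki}+\partial_k\omega_{ij}$; * the (negative) contorsion $\Theta=D-\nabla$, i.e. $\Theta_{ij}^k e_k=D_{e_i}e_j-\nabla_{e_i}e_j$,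 and $\Theta_{ijk}=\Theta_{ij}^l g_{lk}$; * for a connection $\widetilde\nabla$, its curvature $R(X,Y)Z=\widetilde\nabla_X\widetilde\nabla_YZ-\widetilde\nabla_Y\widetilde\nabla_XZ-\widetilde\nabla_{[X,Y]}Z$, with components $R(e_i,e_j)e_k=R_{ijk}^{\;l}e_l$ and $R_{ijkl}=R_{ijk}^{\;s}g_{sl}$; this is denoted $\mathrm{Rm}$ for $D$ and $\Omega$ for $\nabla$; * the Ricci tensor $\mathrm{Rc}_{jk}=\mathrm{Rm}_{ijk}^{\;i}$ and the Chern–Ricci form $\mathcal P_{ab}=\omega^{cd}\Omega_{abcd}$. Then, with $\nabla_i\vartheta_j$ and $\nabla_i\Theta_{jkl}$ the components of the Chern covariant derivatives of $\vartheta$ and $\Theta$, for all $j,k$, $$ \begin{aligned} \mathrm{Rc}_{jk}={}&\tfrac12 J_k^a\mathcal P_{ja}-\tfrac12\nabla_j\vartheta_k+\tfrac12 J_k^aJ_j^u\nabla_a\vartheta_u+g^{il}\nabla_i\Theta_{jkl}+J_k^a\omega^{br}\nabla_b\Theta_{jar}\\ &+J_k^a\omega^{br}\big(\Theta_{ar}^s-\Theta_{ra}^s\big)\Theta_{jbs}+J_k^a\omega^{br}\big(\Theta_{jb}^s-\Theta_{bj}^s\big)\Theta_{sar}+\tfrac12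 J_k^aJ_s^p\vartheta_p\big(\Theta_{ja}^s-\Theta_{aj}^s\big)\\ &+\vartheta_s\Theta_{jk}^s-\Theta_{ij}^s\Theta_{sk}^i . \end{aligned} $$ -/

import Mathlib

open Bundle VectorField
open scoped Manifold ContDiff

noncomputable section

namespace AlmostHermitianGeometry

/-- The model space of an `n`-dimensional manifold. -/
abbrev Model (n : ℕ) : Type := EuclideanSpace ℝ (Fin n)

section Structures

variable {n : ℕ} {M : Type*} [TopologicalSpace M] [ChartedSpace (Model n) M]

/-- Vector fields on `M` (no regularity is implied). -/
abbrev VField (n : ℕ) (M : Type*) [TopologicalSpace M] [ChartedSpace (Model n) M] : Type _ :=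
  (x : M) → TangentSpace (𝓡 n) x

/-- Fields of endomorphisms of the tangent bundle (no regularity is implied). -/
abbrev EndField (n : ℕ) (M : Type*) [TopologicalSpace M] [ChartedSpace (Model n) M] : Type _ :=
  (x : M) → (TangentSpace (𝓡 n) x →L[ℝ] TangentSpace (𝓡 n) x)

variable [IsManifold (𝓡 n) ∞ M]

/-- The vector field `Y` is differentiable at `x`. -/
abbrev VDiffAt (Y : VField n M) (x : M) : Prop :=
  MDifferentiableAt (𝓡 n) ((𝓡 n).prod 𝓘(ℝ, Model n))
    (fun y => (TotalSpace.mk' (Model n) y (Y y) : TangentBundle (𝓡 n) M)) x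

/-- Smooth Riemannian metrics on `M`. -/
abbrev Metric (n : ℕ) (M : Type*) [TopologicalSpace M] [ChartedSpace (Model n) M]
    [IsManifold (𝓡 n) ∞ M] : Type _ :=
  ContMDiffRiemannianMetric (𝓡 n) ∞ (Model n) (fun x : M => TangentSpace (𝓡 n) x)

/-- Affine connections on `M`; `cov Y x v` is the vector `(∇_v Y)(x)`. -/
abbrev Connection (n : ℕ) (M : Type*) [TopologicalSpace M] [ChartedSpace (Model n) M]
    [IsManifold (𝓡 n) ∞ M] : Type _ :=
  CovariantDerivative (𝓡 n) (Model n) (fun x : M => TangentSpace (𝓡 n) x)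

/-- `(M, g, J)` is almost Hermitian: `J` is a smooth field of endomorphisms with `J² = -1` and
`g(JX, JY) = g(X, Y)`. -/
structure IsAlmostHermitian (g : Metric n M) (J : EndField n M) : Prop where
  smooth : ContMDiff (𝓡 n) ((𝓡 n).prod 𝓘(ℝ, Model n →L[ℝ] Model n)) ∞
    (fun x : M => TotalSpace.mk' (Model n →L[ℝ] Model n)
      (E := fun x : M => TangentSpace (𝓡 n) x →L[ℝ] TangentSpace (𝓡 n) x) x (J x))
  sq : ∀ (x : M) (v : TangentSpace (𝓡 n) x), J x (J x v) = -v
  compat : ∀ (x : M) (v w : TangentSpace (𝓡 n) x),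
    g.inner x (J x v) (J x w) = g.inner x v w

/-- `∇g = 0`: `v(g(Y, Z)) = g(∇_v Y, Z) + g(Y, ∇_v Z)`. -/
def IsMetricConnection (g : Metric n M) (cov : Connection n M) : Prop :=
  ∀ (x : M) (Y Z : VField n M), VDiffAt Y x → VDiffAt Z x →
    ∀ v : TangentSpace (𝓡 n) x,
      mvfderiv (𝓡 n) (fun y => g.inner y (Y y) (Z y)) x v
        = g.inner x (cov Y x v) (Z x) + g.inner x (Y x) (cov Z x v)

/-- `∇J = 0`: `∇_v (J Y) = J (∇_v Y)`. -/
def IsComplexConnection (J : EndField n M) (cov : Connection n M) : Prop :=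
  ∀ (x : M) (Y : VField n M), VDiffAt Y x →
    ∀ v : TangentSpace (𝓡 n) x, cov (fun y => J y (Y y)) x v = J x (cov Y x v)

/-- The Levi-Civita connection of `g`: the (unique) smooth torsion-free metric connection. -/
structure IsLeviCivita (g : Metric n M) (cov : Connection n M) : Prop where
  smooth : CovariantDerivative.ContMDiffCovariantDerivative cov ∞
  metric : IsMetricConnection g cov
  torsionFree : cov.torsion = 0

/-- The Chern connection of `(g, J)`: the (unique) smooth connection with `∇g = 0`, `∇J = 0` and
`τ^{1,1} = 0`, where `τ` is the torsion and `τ^{1,1}(v, w) = (τ(v, w) + τ(Jv, Jw)) / 2`. -/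
structure IsChern (g : Metric n M) (J : EndField n M) (cov : Connection n M) : Prop where
  smooth : CovariantDerivative.ContMDiffCovariantDerivative cov ∞
  metric : IsMetricConnection g cov
  complex : IsComplexConnection J cov
  torsion11 : ∀ (x : M) (v w : TangentSpace (𝓡 n) x),
    (1 / 2 : ℝ) • (cov.torsion x v w + cov.torsion x (J x v) (J x w)) = 0

/-- The curvature `R(X, Y)Z = ∇_X ∇_Y Z - ∇_Y ∇_X Z - ∇_{[X, Y]} Z`. -/
def curvature (cov : Connection n M) (X Y Z : VField n M) : VField n M := fun x =>
  cov (fun y => cov Z y (Y y)) x (X x) - cov (fun y => cov Z y (X y)) x (Y x)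
    - cov Z x (mlieBracket (𝓡 n) X Y x)

/-- The Kähler form `ω(v, w) = g(Jv, w)`. -/
def kahlerForm (g : Metric n M) (J : EndField n M) (x : M) (v w : TangentSpace (𝓡 n) x) : ℝ :=
  g.inner x (J x v) w

/-- The exterior derivative `dα(X, Y, Z)` of a `2`-form `α`, by the invariant formula; on
coordinate fields it is `∂ᵢ αⱼₖ + ∂ⱼ αₖᵢ + ∂ₖ αᵢⱼ`. -/
def extDeriv2 (α : (x : M) → TangentSpace (𝓡 n) x → TangentSpace (𝓡 n) x → ℝ)
    (X Y Z : VField n M) (x : M) : ℝ :=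
  mvfderiv (𝓡 n) (fun y => α y (Y y) (Z y)) x (X x)
    + mvfderiv (𝓡 n) (fun y => α y (Z y) (X y)) x (Y x)
    + mvfderiv (𝓡 n) (fun y => α y (X y) (Y y)) x (Z x)
    - α x (mlieBracket (𝓡 n) X Y x) (Z x)
    - α x (mlieBracket (𝓡 n) Y Z x) (X x)
    - α x (mlieBracket (𝓡 n) Z X x) (Y x)

end Structures

/-! Components with respect to a smooth local frame `e₁, …, eₙ` of the tangent bundle over `U`
(for instance the coordinate fields of a chart). All components are functions on `M`, meaningful
on `U`; upper indices are written after the lower ones. -/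

section Components

variable {n : ℕ} {M : Type*} [TopologicalSpace M] [ChartedSpace (Model n) M]
  [IsManifold (𝓡 n) ∞ M]

/-- `e` is a smooth frame of the tangent bundle over `U`. -/
abbrev IsFrame (e : Fin n → VField n M) (U : Set M) : Prop :=
  IsLocalFrameOn (𝓡 n) (Model n) ∞ e U

variable {e : Fin n → VField n M} {U : Set M}

/-- `gᵢⱼ`. -/
def gLow (g : Metric n M) (e : Fin n → VField n M) (i j : Fin n) (x : M) : ℝ :=
  g.inner x (e i x) (e j x)

/-- `gⁱʲ`, the inverse matrix of `gᵢⱼ`. -/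
def gUp (g : Metric n M) (e : Fin n → VField n M) (i j : Fin n) (x : M) : ℝ :=
  (Matrix.of fun a b => gLow g e a b x)⁻¹ i j

/-- `ωᵢⱼ = g(J eᵢ, eⱼ)`. -/
def omegaLow (g : Metric n M) (J : EndField n M) (e : Fin n → VField n M) (i j : Fin n)
    (x : M) : ℝ :=
  kahlerForm g J x (e i x) (e j x)

/-- `ωⁱʲ`, the inverse matrix of `ωᵢⱼ` (not `ω` with indices raised by `g`). -/
def omegaUp (g : Metric n M) (J : EndField n M) (e : Fin n → VField n M) (i j : Fin n)
    (x : M) : ℝ :=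
  (Matrix.of fun a b => omegaLow g J e a b x)⁻¹ i j

/-- `Jᵢᵃ`, where `J eᵢ = ∑ₐ Jᵢᵃ eₐ`. -/
def JComp (he : IsFrame e U) (J : EndField n M) (i a : Fin n) (x : M) : ℝ :=
  he.coeff a x (J x (e i x))

/-- `ψᵢⱼₖ`, where `ψ = dω`. -/
def psi (g : Metric n M) (J : EndField n M) (e : Fin n → VField n M) (i j k : Fin n)
    (x : M) : ℝ :=
  extDeriv2 (kahlerForm g J) (e i) (e j) (e k) x

/-- The Lee form `ϑₖ = ½ ωʲⁱ ψᵢⱼₖ`. -/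
def lee (g : Metric n M) (J : EndField n M) (e : Fin n → VField n M) (k : Fin n) (x : M) : ℝ :=
  (1 / 2 : ℝ) * ∑ i, ∑ j, omegaUp g J e j i x * psi g J e i j k x

/-- The connection coefficients: `∇_{eᵢ} eⱼ = ∑ₖ Υᵢⱼᵏ eₖ`. -/
def connCoeff (he : IsFrame e U) (cov : Connection n M) (i j k : Fin n) (x : M) : ℝ :=
  he.coeff k x (cov (e j) x (e i x))

/-- `Θᵢⱼᵏ`, the components of `D - ∇`. -/
def thetaUp (he : IsFrame e U) (D cov : Connection n M) (i j k : Fin n) (x : M) : ℝ :=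
  connCoeff he D i j k x - connCoeff he cov i j k x

/-- `Θᵢⱼₖ = Θᵢⱼˡ gₗₖ`. -/
def thetaLow (he : IsFrame e U) (g : Metric n M) (D cov : Connection n M) (i j k : Fin n)
    (x : M) : ℝ :=
  ∑ l, thetaUp he D cov i j l x * gLow g e l k x

/-- `Rᵢⱼₖˡ`, where `R(eᵢ, eⱼ) eₖ = ∑ₗ Rᵢⱼₖˡ eₗ`. -/
def curvUp (he : IsFrame e U) (cov : Connection n M) (i j k l : Fin n) (x : M) : ℝ :=
  he.coeff l x (curvature cov (e i) (e j) (e k) x)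

/-- `Rᵢⱼₖₗ = Rᵢⱼₖˢ gₛₗ`. -/
def curvLow (he : IsFrame e U) (g : Metric n M) (cov : Connection n M) (i j k l : Fin n)
    (x : M) : ℝ :=
  ∑ s, curvUp he cov i j k s x * gLow g e s l x

/-- The Ricci tensor `Rcⱼₖ = Rᵢⱼₖⁱ`, the trace of `X ↦ R(X, eⱼ) eₖ`. -/
def ricci (he : IsFrame e U) (D : Connection n M) (j k : Fin n) (x : M) : ℝ :=
  ∑ i, curvUp he D i j k i x

/-- The Chern-Ricci form `Pₐᵦ = ω^{cd} Ω_{abcd}`. -/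
def chernRicci (he : IsFrame e U) (g : Metric n M) (J : EndField n M) (cov : Connection n M)
    (a b : Fin n) (x : M) : ℝ :=
  ∑ c, ∑ d, omegaUp g J e c d x * curvLow he g cov a b c d x

/-- `∇ᵢ αⱼ` for a covariant `1`-tensor with components `αⱼ`. -/
def nabla1 (he : IsFrame e U) (cov : Connection n M) (α : Fin n → M → ℝ) (i j : Fin n)
    (x : M) : ℝ :=
  mvfderiv (𝓡 n) (α j) x (e i x) - ∑ s, connCoeff he cov i j s x * α s x

/-- `∇ᵢ Bⱼₖₗ` for a covariant `3`-tensor with components `Bⱼₖₗ`. -/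
def nabla3 (he : IsFrame e U) (cov : Connection n M) (B : Fin n → Fin n → Fin n → M → ℝ)
    (i j k l : Fin n) (x : M) : ℝ :=
  mvfderiv (𝓡 n) (B j k l) x (e i x)
    - ∑ s, (connCoeff he cov i j s x * B s k l x + connCoeff he cov i k s x * B j s l x
      + connCoeff he cov i l s x * B j k s x)

end Components

end AlmostHermitianGeometry

end

open AlmostHermitianGeometry

/-!
The Levi-Civita connection is `D = ∇ + Θ`, so its curvature is that of the Chern connection `∇`
plus the antisymmetrized `∇Θ` plus terms quadratic in `Θ` (`curvUp_eq_add`). In the trace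
`Rcⱼₖ = Rmᵢⱼₖⁱ` the term `∇ᵢΘⱼₖⁱ` appears as it stands. Since `∇ω = 0`, the form `dω` is the cyclic
sum of `ω(τ(X, Y), Z)`, and the condition on `τ^{1,1}`, in the form `τ(Jv, w) = τ(v, Jw)`, leaves
only a trace of the torsion in the Lee form: `ϑₖ = Θₛₖˢ` (`lee_eq`). Hence the other derivative
term is `-∇ⱼϑₖ`, and the quadratic terms are `ϑₛ Θⱼₖˢ - Θᵢⱼˢ Θₛₖⁱ`.

What remains is the trace `Ωᵢⱼₖⁱ` of the Chern curvature (`trace_curvUp_chern`). As `Ω` is skew in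
its last two arguments and commutes with `J`, the trace equals `Jₖᵃ ωⁱᵐ Ωⱼᵢₐₘ`
(`IsHermitianData.trace_curvature`). The pair symmetry of a Riemannian curvature tensor, which would
turn this into the Chern-Ricci form, fails for `Ω` by the cyclic sums of `Ω`, so
`2 ωⁱᵐ Ωⱼᵢₐₘ = Pⱼₐ + (contractions of cyclic sums)` (`IsHermitianData.contr_curvature`). The first
Bianchi identity writes the cyclic sum as that of `∇τ + τ(τ(·, ·), ·)`; it follows from the Bianchi
identity of `D`, that is, from the Jacobi identity (`bianchi_chern`). Finally
`τ(Jv, w) = τ(v, Jw)`, which `∇τ` inherits because `∇J = 0`, makes the contractions of `τ` and `∇τ`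
with `ω⁻¹` over their first two indices vanish and turns those over the first and third into
`J` applied to a trace. This gives the terms with `∇ϑ`, `∇Θ` and the torsion
(`IsHermitianData.contr_torsion`).

The skew-symmetry of the curvature of a metric connection rests on `[X, Y] f = X (Y f) - Y (X f)`,
which is extracted from the Jacobi identity (`mvfderiv_mlieBracket`).
-/

noncomputable section

namespace AlmostHermitianGeometry

open scoped Topology

/-! ### Smooth functions and vector fields -/

section Smoothness

variable {n : ℕ} {M : Type*} [TopologicalSpace M] [ChartedSpace (Model n) M] {U : Set M} {x : M}

/-- The real function `f` is smooth on `U`. -/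
abbrev FunSmoothOn (n : ℕ) {M : Type*} [TopologicalSpace M] [ChartedSpace (Model n) M]
    (f : M → ℝ) (U : Set M) : Prop :=
  ContMDiffOn (𝓡 n) 𝓘(ℝ, ℝ) ∞ f U

lemma FunSmoothOn.mdiffAt {f : M → ℝ} (hf : FunSmoothOn n f U) (hU : IsOpen U) (hx : x ∈ U) :
    MDifferentiableAt (𝓡 n) 𝓘(ℝ, ℝ) f x :=
  (hf.contMDiffAt (hU.mem_nhds hx)).mdifferentiableAt (by simp)

lemma FunSmoothOn.sum {ι : Type*} {s : Finset ι} {f : ι → M → ℝ}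
    (hf : ∀ i ∈ s, FunSmoothOn n (f i) U) :
    FunSmoothOn n (fun y => ∑ i ∈ s, f i y) U :=
  contMDiffOn_finsetSum hf

lemma FunSmoothOn.prod {ι : Type*} {s : Finset ι} {f : ι → M → ℝ}
    (hf : ∀ i ∈ s, FunSmoothOn n (f i) U) :
    FunSmoothOn n (fun y => ∏ i ∈ s, f i y) U :=
  contMDiffOn_finsetProd hf

lemma FunSmoothOn.mul {f h : M → ℝ} (hf : FunSmoothOn n f U) (hh : FunSmoothOn n h U) :
    FunSmoothOn n (fun y => f y * h y) U := ContMDiffOn.mul hf hh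

lemma FunSmoothOn.sub {f h : M → ℝ} (hf : FunSmoothOn n f U) (hh : FunSmoothOn n h U) :
    FunSmoothOn n (fun y => f y - h y) U := ContMDiffOn.sub hf hh

lemma FunSmoothOn.add {f h : M → ℝ} (hf : FunSmoothOn n f U) (hh : FunSmoothOn n h U) :
    FunSmoothOn n (fun y => f y + h y) U := ContMDiffOn.add hf hh

lemma FunSmoothOn.matrix_det {ι : Type*} [Fintype ι] [DecidableEq ι] {A : M → Matrix ι ι ℝ}
    (hA : ∀ i j, FunSmoothOn n (fun y => A y i j) U) :
    FunSmoothOn n (fun y => (A y).det) U := by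
  simp only [Matrix.det_apply']
  exact FunSmoothOn.sum fun σ _ => FunSmoothOn.mul contMDiffOn_const
    (FunSmoothOn.prod fun i _ => hA _ _)

lemma FunSmoothOn.matrix_inv {ι : Type*} [Fintype ι] [DecidableEq ι] {A : M → Matrix ι ι ℝ}
    (hA : ∀ i j, FunSmoothOn n (fun y => A y i j) U) (hdet : ∀ y ∈ U, (A y).det ≠ 0) (i j : ι) :
    FunSmoothOn n (fun y => (A y)⁻¹ i j) U := by
  have h : (fun y => (A y)⁻¹ i j) = fun y => ((A y).det)⁻¹ * (A y).adjugate i j := by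
    funext y
    simp [Matrix.inv_def, Ring.inverse_eq_inv']
  rw [h]
  refine FunSmoothOn.mul (ContMDiffOn.inv₀ (FunSmoothOn.matrix_det hA) hdet) ?_
  simp only [Matrix.adjugate_apply]
  refine FunSmoothOn.matrix_det fun a b => ?_
  by_cases h : a = j
  · subst h; simpa using contMDiffOn_const
  · simpa [Matrix.updateRow_apply, h] using hA a b

variable [IsManifold (𝓡 n) ∞ M] {X Y Z W : VField n M} {g : Metric n M} {J : EndField n M}

/-- The vector field `Y` is smooth on `U`. -/
abbrev SmoothOn (Y : VField n M) (U : Set M) : Prop :=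
  ContMDiffOn (𝓡 n) ((𝓡 n).prod 𝓘(ℝ, Model n)) ∞
    (fun y => (TotalSpace.mk' (Model n) y (Y y) : TangentBundle (𝓡 n) M)) U

lemma SmoothOn.vdiffAt (hY : SmoothOn Y U) (hU : IsOpen U) (hx : x ∈ U) : VDiffAt Y x :=
  (hY.contMDiffAt (hU.mem_nhds hx)).mdifferentiableAt (by simp)

lemma SmoothOn.inner (g : Metric n M) (hY : SmoothOn Y U) (hZ : SmoothOn Z U) :
    FunSmoothOn n (fun y => g.inner y (Y y) (Z y)) U := by
  have h := g.contMDiff.contMDiffOn (s := U)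
  have h2 := ContMDiffOn.clm_bundle_apply₂ (F₁ := Model n) (F₂ := Model n) (F₃ := ℝ)
    (E₃ := Bundle.Trivial M ℝ) h hY hZ
  intro y hy
  have h3 := h2 y hy
  rw [contMDiffWithinAt_totalSpace] at h3
  exact h3.2

lemma IsAlmostHermitian.smoothOn (hJ : IsAlmostHermitian g J) (hY : SmoothOn Y U) :
    SmoothOn (fun y => J y (Y y)) U :=
  ContMDiffOn.clm_bundle_apply hJ.smooth.contMDiffOn hY

lemma SmoothOn.sum {ι : Type*} {s : Finset ι} {f : ι → M → ℝ} {Z : ι → VField n M}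
    (hf : ∀ i ∈ s, FunSmoothOn n (f i) U) (hZ : ∀ i ∈ s, SmoothOn (Z i) U) :
    SmoothOn (fun y => ∑ i ∈ s, f i y • Z i y) U :=
  ContMDiffOn.sum_section fun i hi => (hf i hi).smul_section (hZ i hi)

end Smoothness

/-! ### Frames -/

section Frames

variable {n : ℕ} {M : Type*} [TopologicalSpace M] [ChartedSpace (Model n) M]
  [IsManifold (𝓡 n) ∞ M] {U : Set M} {x : M} {X Y Z W : VField n M} {g : Metric n M}
  {e : Fin n → VField n M}

lemma inner_self_eq_zero (g : Metric n M) (v : TangentSpace (𝓡 n) x) (h : g.inner x v v = 0) :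
    v = 0 := by
  by_contra hv
  exact (g.pos x v hv).ne' h

lemma sum_coeff (he : IsFrame e U) (hx : x ∈ U) (v : TangentSpace (𝓡 n) x) :
    ∑ i, he.coeff i x v • e i x = v := by
  have := (he.toBasisAt hx).sum_repr v
  simpa [IsLocalFrameOn.coeff, hx] using this

lemma coeff_sum (he : IsFrame e U) (hx : x ∈ U) (c : Fin n → ℝ) (i : Fin n) :
    he.coeff i x (∑ j, c j • e j x) = c i := by
  have := (he.toBasisAt hx).repr_sum_self c
  simpa [IsLocalFrameOn.coeff, hx] using congrFun this i

/-- The Gram matrix of a frame is invertible. -/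
lemma gLow_det_ne_zero (he : IsFrame e U) (hx : x ∈ U) (g : Metric n M) :
    (Matrix.of fun a b => gLow g e a b x).det ≠ 0 := by
  intro h0
  obtain ⟨v, hv, hmul⟩ := Matrix.exists_mulVec_eq_zero_iff.2 h0
  have hz : (∑ j, v j • e j x) = 0 := by
    apply inner_self_eq_zero g
    have hk : ∀ k, g.inner x (e k x) (∑ j, v j • e j x) = 0 := fun k => by
      have := congrFun hmul k
      simp only [Matrix.mulVec, dotProduct, Matrix.of_apply, gLow, Pi.zero_apply] at this
      simp only [map_sum, map_smul, smul_eq_mul]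
      rw [← this]
      exact Finset.sum_congr rfl fun j _ => mul_comm _ _
    rw [map_sum]
    refine Finset.sum_eq_zero fun k _ => ?_
    rw [map_smul, g.symm, hk, smul_zero]
  apply hv
  funext i
  rw [← coeff_sum he hx v i, hz]
  simp

lemma gLow_symm (g : Metric n M) (e : Fin n → VField n M) (i j : Fin n) (x : M) :
    gLow g e i j x = gLow g e j i x := g.symm _ _ _

lemma gUp_symm (g : Metric n M) (e : Fin n → VField n M) (i j : Fin n) (x : M) :
    gUp g e i j x = gUp g e j i x := by
  have h : (Matrix.of fun a b => gLow g e a b x).transpose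
      = Matrix.of fun a b => gLow g e a b x := by
    ext a b; simp [gLow_symm g e a b]
  unfold gUp
  rw [← Matrix.transpose_apply (Matrix.of fun a b => gLow g e a b x)⁻¹ j i,
    Matrix.transpose_nonsing_inv, h]

lemma sum_gUp_gLow (he : IsFrame e U) (hx : x ∈ U) (g : Metric n M) (i j : Fin n) :
    ∑ k, gUp g e i k x * gLow g e k j x = if i = j then 1 else 0 := by
  have h := Matrix.nonsing_inv_mul (Matrix.of fun a b => gLow g e a b x)
    (isUnit_iff_ne_zero.2 (gLow_det_ne_zero he hx g))
  have := congrFun (congrFun h i) j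
  simpa [Matrix.mul_apply, Matrix.one_apply, gUp] using this

lemma coeff_eq_sum_gUp (he : IsFrame e U) (hx : x ∈ U) (g : Metric n M) (i : Fin n)
    (v : TangentSpace (𝓡 n) x) :
    he.coeff i x v = ∑ k, gUp g e i k x * g.inner x (e k x) v := by
  have h : ∀ k, g.inner x (e k x) v = ∑ j, gLow g e k j x * he.coeff j x v := fun k => by
    conv_lhs => rw [← sum_coeff he hx v]
    simp only [map_sum, map_smul, smul_eq_mul, gLow]
    exact Finset.sum_congr rfl fun j _ => mul_comm _ _
  simp only [h, Finset.mul_sum, ← mul_assoc]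
  rw [Finset.sum_comm]
  simp only [← Finset.sum_mul, sum_gUp_gLow he hx g]
  simp

lemma SmoothOn.coeff (he : IsFrame e U) (g : Metric n M) (hY : SmoothOn Y U) (i : Fin n) :
    FunSmoothOn n (fun y => he.coeff i y (Y y)) U := by
  have h : FunSmoothOn n (fun y => ∑ k, gUp g e i k y * g.inner y (e k y) (Y y)) U := by
    refine FunSmoothOn.sum fun k _ => FunSmoothOn.mul ?_ (SmoothOn.inner g (he.contMDiffOn k) hY)
    exact FunSmoothOn.matrix_inv
      (fun a b => SmoothOn.inner g (he.contMDiffOn a) (he.contMDiffOn b))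
      (fun y hy => gLow_det_ne_zero he hy g) i k
  exact h.congr fun y hy => coeff_eq_sum_gUp he hy g i (Y y)

end Frames

/-! ### Lie brackets -/

section Bracket

variable {n : ℕ} {M : Type*} [TopologicalSpace M] [ChartedSpace (Model n) M] {U : Set M} {x : M}
  {X Y Z : VField n M}

lemma mlieBracket_congr_right (hU : IsOpen U) (hx : x ∈ U) (h : ∀ y ∈ U, Y y = Z y) :
    mlieBracket (𝓡 n) X Y x = mlieBracket (𝓡 n) X Z x :=
  Filter.EventuallyEq.mlieBracket_vectorField_eq Filter.EventuallyEq.rfl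
    (Filter.eventually_of_mem (hU.mem_nhds hx) h)

end Bracket

/-! ### Connections and the Jacobi identity -/

section Connections

variable {n : ℕ} {M : Type*} [TopologicalSpace M] [ChartedSpace (Model n) M]
  [IsManifold (𝓡 n) ∞ M] {U : Set M} {x : M} {X Y Z W : VField n M} {g : Metric n M}
  {e : Fin n → VField n M} {cov : Connection n M}

lemma cov_congr (cov : Connection n M) (hU : IsOpen U) (hx : x ∈ U) (hY : VDiffAt Y x)
    (hZ : VDiffAt Z x) (h : ∀ y ∈ U, Y y = Z y) : cov Y x = cov Z x :=
  cov.isCovariantDerivativeOnUniv.congr_of_eventuallyEq hY hZ Filter.univ_mem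
    (Filter.eventually_of_mem (hU.mem_nhds hx) h)

/-- A smooth connection maps vector fields smooth on an open set to vector fields smooth there.
Smoothness of the connection only speaks of global fields, so the given field is first cut off
by a bump function. -/
lemma SmoothOn.covariantDerivative [T2Space M]
    (hcov : CovariantDerivative.ContMDiffCovariantDerivative cov ∞) (hU : IsOpen U)
    (hX : SmoothOn X U) (hY : SmoothOn Y U) : SmoothOn (fun y => cov Y y (X y)) U := by
  intro x hx
  obtain ⟨f, hf⟩ := (SmoothBumpFunction.nhds_basis_tsupport (I := 𝓡 n) x).mem_iff.1
    (hU.mem_nhds hx)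
  set Y' : VField n M := fun y => f y • Y y with hY'
  have hY's : SmoothOn Y' Set.univ := by
    intro y _
    by_cases hy : y ∈ U
    · have h1 : SmoothOn Y' U := (f.contMDiff.contMDiffOn).smul_section hY
      exact (h1.contMDiffAt (hU.mem_nhds hy)).contMDiffWithinAt
    · have h2 : ∀ᶠ z in 𝓝 y, Y' z = 0 := by
        have : y ∉ tsupport f := fun h => hy (hf.2 h)
        filter_upwards [(isClosed_tsupport f).isOpen_compl.mem_nhds this] with z hz
        simp [hY', image_eq_zero_of_notMem_tsupport hz]
      have h3 : ContMDiffAt (𝓡 n) ((𝓡 n).prod 𝓘(ℝ, Model n)) ∞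
          (fun z => (TotalSpace.mk' (Model n) z (0 : TangentSpace (𝓡 n) z) :
            TangentBundle (𝓡 n) M)) y :=
        (contMDiff_zeroSection ℝ (fun z : M => TangentSpace (𝓡 n) z)).contMDiffAt
      refine (h3.congr_of_eventuallyEq ?_).contMDiffWithinAt
      filter_upwards [h2] with z hz
      rw [hz]
  have h4 := hcov.contMDiff.contMDiff (σ := Y') (by simpa using hY's)
  have h5 : SmoothOn (fun y => cov Y' y (X y)) U :=
    ContMDiffOn.clm_bundle_apply (h4.mono (Set.subset_univ _)) hX
  have h6 : ∀ᶠ y in 𝓝 x, Y' y = Y y := by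
    filter_upwards [f.eventuallyEq_one] with y hy
    simp [hY', hy]
  refine ((h5.contMDiffAt (hU.mem_nhds hx)).congr_of_eventuallyEq ?_).contMDiffWithinAt
  filter_upwards [eventually_eventually_nhds.2 h6, hU.mem_nhds hx] with y hy hyU
  have : cov Y y = cov Y' y := cov.isCovariantDerivativeOnUniv.congr_of_eventuallyEq
    (hY.vdiffAt hU hyU) (hY's.vdiffAt isOpen_univ trivial) Filter.univ_mem
    (hy.mono fun _ h => h.symm)
  simp only [this]

lemma SmoothOn.mlieBracket (hU : IsOpen U) (hX : SmoothOn X U) (hY : SmoothOn Y U) :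
    SmoothOn (mlieBracket (𝓡 n) X Y) U := by
  intro x hx
  have : IsManifold (𝓡 n) (((⊤ : ℕ∞) : WithTop ℕ∞) + 1) M := by
    simpa using (inferInstance : IsManifold (𝓡 n) ∞ M)
  have : IsManifold (𝓡 n) (minSmoothness ℝ 2) M := by
    simp only [minSmoothness_of_isRCLikeNormedField]
    infer_instance
  exact (ContMDiffAt.mlieBracket_vectorField (m := ⊤) (n := ⊤)
    (hX.contMDiffAt (hU.mem_nhds hx)) (hY.contMDiffAt (hU.mem_nhds hx))
    (by simp)).contMDiffWithinAt

/-- The Jacobi identity on an open set where the fields are smooth. -/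
lemma jacobi (hU : IsOpen U) (hx : x ∈ U) (hX : SmoothOn X U) (hY : SmoothOn Y U)
    (hZ : SmoothOn Z U) :
    mlieBracket (𝓡 n) X (mlieBracket (𝓡 n) Y Z) x
      = mlieBracket (𝓡 n) (mlieBracket (𝓡 n) X Y) Z x
        + mlieBracket (𝓡 n) Y (mlieBracket (𝓡 n) X Z) x := by
  have : IsManifold (𝓡 n) (minSmoothness ℝ 3) M := by
    simp only [minSmoothness_of_isRCLikeNormedField]
    infer_instance
  have h : ∀ {T : VField n M}, SmoothOn T U → ContMDiffAt (𝓡 n) (𝓡 n).tangent (minSmoothness ℝ 2)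
      (fun y => (TotalSpace.mk' (Model n) y (T y) : TangentBundle (𝓡 n) M)) x := fun hT => by
    simp only [minSmoothness_of_isRCLikeNormedField]
    exact (hT.contMDiffAt (hU.mem_nhds hx)).of_le ENat.LEInfty.out
  exact leibniz_identity_mlieBracket_apply (h hX) (h hY) (h hZ)

/-- `[X, Y] f = X (Y f) - Y (X f)`. The Jacobi identity for `X`, `Y` and `f Z`, where `Z` is a
field that does not vanish at the point, contains this identity as the coefficient of `Z`. -/
lemma mvfderiv_mlieBracket (he : IsFrame e U) (hU : IsOpen U) (hx : x ∈ U) (hX : SmoothOn X U)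
    (hY : SmoothOn Y U) {f : M → ℝ} (hf : FunSmoothOn n f U)
    (hXf : FunSmoothOn n (fun y => mvfderiv (𝓡 n) f y (X y)) U)
    (hYf : FunSmoothOn n (fun y => mvfderiv (𝓡 n) f y (Y y)) U) :
    mvfderiv (𝓡 n) f x (mlieBracket (𝓡 n) X Y x)
      = mvfderiv (𝓡 n) (fun y => mvfderiv (𝓡 n) f y (Y y)) x (X x)
        - mvfderiv (𝓡 n) (fun y => mvfderiv (𝓡 n) f y (X y)) x (Y x) := by
  have : IsManifold (𝓡 n) 2 M := inferInstance
  rcases isEmpty_or_nonempty (Fin n) with hn | ⟨⟨k⟩⟩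
  · have h0 : ∀ v : TangentSpace (𝓡 n) x, v = 0 := fun v => by
      rw [← sum_coeff he hx v]; simp
    rw [h0 (mlieBracket (𝓡 n) X Y x), h0 (X x), h0 (Y x)]
    simp
  set Z := e k with hZdef
  have hZ : SmoothOn Z U := he.contMDiffOn k
  have hbr : ∀ {T : VField n M}, SmoothOn T U → ∀ {h : M → ℝ}, FunSmoothOn n h U →
      ∀ {S : VField n M}, SmoothOn S U → ∀ y ∈ U,
      mlieBracket (𝓡 n) T (h • S) y
        = (mvfderiv (𝓡 n) h y (T y)) • S y + h y • mlieBracket (𝓡 n) T S y :=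
    fun {T} hT {h} hh {S} hS y hy =>
      mlieBracket_smul_right (hh.mdiffAt hU hy) (hS.vdiffAt hU hy)
  have key : ∀ {T S : VField n M}, SmoothOn T U → SmoothOn S U →
      FunSmoothOn n (fun y => mvfderiv (𝓡 n) f y (S y)) U →
      mlieBracket (𝓡 n) T (mlieBracket (𝓡 n) S (f • Z)) x
        = mvfderiv (𝓡 n) (fun y => mvfderiv (𝓡 n) f y (S y)) x (T x) • Z x
          + mvfderiv (𝓡 n) f x (S x) • mlieBracket (𝓡 n) T Z x
          + mvfderiv (𝓡 n) f x (T x) • mlieBracket (𝓡 n) S Z x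
          + f x • mlieBracket (𝓡 n) T (mlieBracket (𝓡 n) S Z) x := by
    intro T S hT hS hSf
    have hSZ := SmoothOn.mlieBracket hU hS hZ
    rw [mlieBracket_congr_right (Z := (fun y => mvfderiv (𝓡 n) f y (S y)) • Z
      + f • mlieBracket (𝓡 n) S Z) hU hx (hbr hS hf hZ),
      mlieBracket_add_right (SmoothOn.vdiffAt (ContMDiffOn.smul_section hSf hZ) hU hx)
        (SmoothOn.vdiffAt (ContMDiffOn.smul_section hf hSZ) hU hx),
      hbr hT hSf hZ x hx, hbr hT hf hSZ x hx]
    module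
  have hJ := jacobi hU hx hX hY (ContMDiffOn.smul_section hf hZ)
  have hJ0 := jacobi hU hx hX hY hZ
  rw [key hX hY hYf, key hY hX hXf, hbr (SmoothOn.mlieBracket hU hX hY) hf hZ x hx, hJ0] at hJ
  have hfin : (mvfderiv (𝓡 n) f x (mlieBracket (𝓡 n) X Y x)
      - (mvfderiv (𝓡 n) (fun y => mvfderiv (𝓡 n) f y (Y y)) x (X x)
        - mvfderiv (𝓡 n) (fun y => mvfderiv (𝓡 n) f y (X y)) x (Y x))) • Z x = 0 := by
    rw [← sub_eq_zero] at hJ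
    rw [← neg_eq_zero, ← hJ]
    module
  rcases smul_eq_zero.1 hfin with h | h
  · linarith
  · exact absurd h ((he.linearIndependent hx).ne_zero k)

end Connections

/-! ### Derivatives of functions -/

section Derivatives

variable {n : ℕ} {M : Type*} [TopologicalSpace M] [ChartedSpace (Model n) M] {U : Set M} {x : M}

lemma mvfderiv_congr (hU : IsOpen U) (hx : x ∈ U) {f h : M → ℝ} (hfh : ∀ y ∈ U, f y = h y) :
    mvfderiv (𝓡 n) f x = mvfderiv (𝓡 n) h x := by
  have h1 : f =ᶠ[𝓝 x] h := Filter.eventually_of_mem (hU.mem_nhds hx) hfh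
  have h2 := h1.mfderiv_eq (I := 𝓡 n) (I' := 𝓘(ℝ, ℝ))
  ext v
  exact congrArg (fun L : TangentSpace (𝓡 n) x →L[ℝ] ℝ => L v) h2

lemma mvfderiv_finset_sum {ι : Type*} (s : Finset ι) {f : ι → M → ℝ}
    (hf : ∀ i ∈ s, MDifferentiableAt (𝓡 n) 𝓘(ℝ, ℝ) (f i) x) :
    mvfderiv (𝓡 n) (fun y => ∑ i ∈ s, f i y) x = ∑ i ∈ s, mvfderiv (𝓡 n) (f i) x := by
  classical
  induction s using Finset.induction_on with
  | empty => simp [mvfderiv_const]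
  | insert a s ha ih =>
    have h1 : ∀ i ∈ s, MDifferentiableAt (𝓡 n) 𝓘(ℝ, ℝ) (f i) x := fun i hi =>
      hf i (Finset.mem_insert_of_mem hi)
    have h2 : MDifferentiableAt (𝓡 n) 𝓘(ℝ, ℝ) (fun y => ∑ i ∈ s, f i y) x := by
      clear ih hf ha
      induction s using Finset.induction_on with
      | empty => simpa using mdifferentiableAt_const
      | insert b t hb ih =>
        simp only [Finset.sum_insert hb]
        exact (h1 b (Finset.mem_insert_self _ _)).add
          (ih fun i hi => h1 i (Finset.mem_insert_of_mem hi))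
    simp only [Finset.sum_insert ha]
    rw [← ih h1, ← mvfderiv_add (hf a (Finset.mem_insert_self _ _)) h2]
    rfl

end Derivatives

/-! ### Connection coefficients and curvature -/

section Connections

variable {n : ℕ} {M : Type*} [TopologicalSpace M] [ChartedSpace (Model n) M]
  [IsManifold (𝓡 n) ∞ M] {U : Set M} {x : M} {X Y Z W : VField n M} {g : Metric n M}
  {J : EndField n M} {e : Fin n → VField n M} {cov D C : Connection n M}

lemma cov_sub (cov : Connection n M) (hY : VDiffAt Y x) (hZ : VDiffAt Z x) :
    cov (fun y => Y y - Z y) x = cov Y x - cov Z x := by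
  have h1 := cov.isCovariantDerivativeOnUniv.smul_const (-1 : ℝ) hZ
  have hZ' : VDiffAt ((-1 : ℝ) • Z) x := mdifferentiableAt_const.smul_section hZ
  have h2 := cov.isCovariantDerivativeOnUniv.add hY hZ'
  have h3 : (fun y => Y y - Z y) = Y + (-1 : ℝ) • Z := by
    funext y; simp [sub_eq_add_neg]
  rw [h3, h2, h1]
  module

lemma cov_finset_sum {ι : Type*} (cov : Connection n M) (s : Finset ι) {f : ι → M → ℝ}
    {Z : ι → VField n M} (hf : ∀ i ∈ s, MDifferentiableAt (𝓡 n) 𝓘(ℝ, ℝ) (f i) x)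
    (hZ : ∀ i ∈ s, VDiffAt (Z i) x) (v : TangentSpace (𝓡 n) x) :
    cov (fun y => ∑ i ∈ s, f i y • Z i y) x v
      = ∑ i ∈ s, (f i x • cov (Z i) x v + mvfderiv (𝓡 n) (f i) x v • Z i x) := by
  classical
  induction s using Finset.induction_on with
  | empty =>
    have := congrFun cov.zero x
    simp only [Finset.sum_empty]
    exact congrArg (fun L : TangentSpace (𝓡 n) x →L[ℝ] TangentSpace (𝓡 n) x => L v) this
  | insert a s ha ih =>
    have h1 : ∀ i ∈ s, VDiffAt (fun y => f i y • Z i y) x := fun i hi =>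
      (hf i (Finset.mem_insert_of_mem hi)).smul_section (hZ i (Finset.mem_insert_of_mem hi))
    have h2 : VDiffAt (fun y => ∑ i ∈ s, f i y • Z i y) x := MDifferentiableAt.sum_section h1
    have h3 : VDiffAt (f a • Z a) x :=
      (hf a (Finset.mem_insert_self _ _)).smul_section (hZ a (Finset.mem_insert_self _ _))
    have h4 := cov.isCovariantDerivativeOnUniv.add h3 h2
    have h5 := cov.isCovariantDerivativeOnUniv.leibniz (hZ a (Finset.mem_insert_self _ _))
      (hf a (Finset.mem_insert_self _ _))
    have h6 : (fun y => ∑ i ∈ insert a s, f i y • Z i y)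
        = (f a • Z a) + fun y => ∑ i ∈ s, f i y • Z i y := by
      funext y; simp [Finset.sum_insert ha]
    rw [Finset.sum_insert ha, h6, ← ih (fun i hi => hf i (Finset.mem_insert_of_mem hi))
      (fun i hi => hZ i (Finset.mem_insert_of_mem hi)), h4, h5]
    simp

/-- The components of `∇_{eᵢ} Y`. -/
lemma coeff_cov (he : IsFrame e U) (hU : IsOpen U) (hx : x ∈ U) (g : Metric n M)
    (cov : Connection n M) (hY : SmoothOn Y U) (i l : Fin n) :
    he.coeff l x (cov Y x (e i x))
      = mvfderiv (𝓡 n) (fun y => he.coeff l y (Y y)) x (e i x)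
        + ∑ s, he.coeff s x (Y x) * connCoeff he cov i s l x := by
  have hc := fun s => (hY.coeff he g s).mdiffAt hU hx
  have he' := fun s => SmoothOn.vdiffAt (he.contMDiffOn s) hU hx
  have h1 : cov Y x = cov (fun y => ∑ s, he.coeff s y (Y y) • e s y) x :=
    cov_congr cov hU hx (hY.vdiffAt hU hx)
      (SmoothOn.vdiffAt (SmoothOn.sum (fun s _ => hY.coeff he g s)
        fun s _ => he.contMDiffOn s) hU hx)
      fun y hy => (sum_coeff he hy (Y y)).symm
  rw [h1, cov_finset_sum cov _ (fun s _ => hc s) (fun s _ => he' s), Finset.sum_add_distrib,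
    map_add, coeff_sum he hx, add_comm]
  simp [connCoeff]

/-- The components of `∇_V Y` in terms of those of `V`. -/
lemma coeff_cov_apply (he : IsFrame e U) (hx : x ∈ U) (cov : Connection n M) (Y : VField n M)
    (v : TangentSpace (𝓡 n) x) (l : Fin n) :
    he.coeff l x (cov Y x v) = ∑ s, he.coeff s x v * he.coeff l x (cov Y x (e s x)) := by
  conv_lhs => rw [← sum_coeff he hx v]
  simp

lemma smooth_connCoeff [T2Space M] (he : IsFrame e U) (hU : IsOpen U) (g : Metric n M)
    (hcov : CovariantDerivative.ContMDiffCovariantDerivative cov ∞) (i j k : Fin n) :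
    FunSmoothOn n (connCoeff he cov i j k) U :=
  SmoothOn.coeff he g
    (SmoothOn.covariantDerivative hcov hU (he.contMDiffOn i) (he.contMDiffOn j)) k

/-- The components of `[eᵢ, eⱼ]`. -/
def bracketCoeff (he : IsFrame e U) (i j k : Fin n) (x : M) : ℝ :=
  he.coeff k x (mlieBracket (𝓡 n) (e i) (e j) x)

/-- The curvature in terms of the connection coefficients. -/
lemma curvUp_eq [T2Space M] (he : IsFrame e U) (hU : IsOpen U) (hx : x ∈ U) (g : Metric n M)
    (hcov : CovariantDerivative.ContMDiffCovariantDerivative cov ∞) (i j k l : Fin n) :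
    curvUp he cov i j k l x
      = mvfderiv (𝓡 n) (connCoeff he cov j k l) x (e i x)
        - mvfderiv (𝓡 n) (connCoeff he cov i k l) x (e j x)
        + ∑ s, (connCoeff he cov j k s x * connCoeff he cov i s l x
          - connCoeff he cov i k s x * connCoeff he cov j s l x
          - bracketCoeff he i j s x * connCoeff he cov s k l x) := by
  have hs : ∀ a b, SmoothOn (fun y => cov (e b) y (e a y)) U := fun a b =>
    SmoothOn.covariantDerivative hcov hU (he.contMDiffOn a) (he.contMDiffOn b)
  have h1 := coeff_cov he hU hx g cov (hs j k) i l
  have h2 := coeff_cov he hU hx g cov (hs i k) j l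
  have h3 := coeff_cov_apply he hx cov (e k) (mlieBracket (𝓡 n) (e i) (e j) x) l
  simp only [curvUp, curvature, map_sub, h1, h2, h3, Finset.sum_sub_distrib]
  have h4 : ∀ a b c, connCoeff he cov a b c = fun y => he.coeff c y (cov (e b) y (e a y)) :=
    fun _ _ _ => rfl
  simp only [h4, bracketCoeff]
  ring

lemma bracketCoeff_eq_of_torsionFree (he : IsFrame e U) (hU : IsOpen U) (hx : x ∈ U)
    (hD : D.torsion = 0) (i j k : Fin n) :
    bracketCoeff he i j k x = connCoeff he D i j k x - connCoeff he D j i k x := by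
  have h := D.torsion_eq_zero_iff.1 hD (SmoothOn.vdiffAt (he.contMDiffOn i) hU hx)
    (SmoothOn.vdiffAt (he.contMDiffOn j) hU hx)
  simp only [bracketCoeff, connCoeff, ← h, map_sub]

/-- The torsion of `∇` in terms of the difference from a torsion-free connection. -/
lemma coeff_torsion (he : IsFrame e U) (hU : IsOpen U) (hx : x ∈ U)
    (hD : D.torsion = 0) (i j k : Fin n) :
    he.coeff k x (C.torsion x (e i x) (e j x))
      = thetaUp he D C j i k x - thetaUp he D C i j k x := by
  have h := bracketCoeff_eq_of_torsionFree he hU hx hD i j k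
  rw [C.torsion_apply (SmoothOn.vdiffAt (he.contMDiffOn i) hU hx)
    (SmoothOn.vdiffAt (he.contMDiffOn j) hU hx)]
  simp only [bracketCoeff, connCoeff, thetaUp, map_sub] at h ⊢
  linarith

/-- The first Bianchi identity of a torsion-free connection: the cyclic sum of `R(X, Y)Z` is the
cyclic sum of `[X, [Y, Z]]`, which vanishes by the Jacobi identity. -/
lemma bianchi_of_torsionFree [T2Space M] (hU : IsOpen U) (hx : x ∈ U)
    (hs : CovariantDerivative.ContMDiffCovariantDerivative D ∞) (hD : D.torsion = 0)
    (hX : SmoothOn X U) (hY : SmoothOn Y U) (hZ : SmoothOn Z U) :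
    curvature D X Y Z x + curvature D Y Z X x + curvature D Z X Y x = 0 := by
  have hsm : ∀ {S T : VField n M}, SmoothOn S U → SmoothOn T U →
      SmoothOn (fun y => D T y (S y)) U := fun hS hT => hS.covariantDerivative hs hU hT
  have h1 : ∀ {R S T : VField n M}, SmoothOn R U → SmoothOn S U → SmoothOn T U →
      D (fun y => D T y (S y)) x (R x) - D (fun y => D S y (T y)) x (R x)
        - D R x (mlieBracket (𝓡 n) S T x)
        = mlieBracket (𝓡 n) R (mlieBracket (𝓡 n) S T) x := by
    intro R S T hR hS hT
    have hST := SmoothOn.mlieBracket hU hS hT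
    rw [← D.torsion_eq_zero_iff.1 hD (hR.vdiffAt hU hx) (hST.vdiffAt hU hx),
      ← sub_apply, ← cov_sub D ((hsm hS hT).vdiffAt hU hx)
        ((hsm hT hS).vdiffAt hU hx)]
    have h2 : SmoothOn (fun y => D T y (S y) - D S y (T y)) U :=
      ContMDiffOn.sub_section (hsm hS hT) (hsm hT hS)
    rw [cov_congr D hU hx (h2.vdiffAt hU hx)
      (hST.vdiffAt hU hx)
      fun y hy => D.torsion_eq_zero_iff.1 hD (hS.vdiffAt hU hy) (hT.vdiffAt hU hy)]
  have hJ := jacobi hU hx hX hY hZ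
  rw [mlieBracket_swap_apply (V := mlieBracket (𝓡 n) X Y), mlieBracket_swap (V := X) (W := Z)] at hJ
  have hneg : mlieBracket (𝓡 n) Y (-mlieBracket (𝓡 n) Z X) x
      = -mlieBracket (𝓡 n) Y (mlieBracket (𝓡 n) Z X) x := by
    have : IsManifold (𝓡 n) 2 M := inferInstance
    have := mlieBracket_const_smul_right (I := 𝓡 n) (V := Y) (c := (-1 : ℝ))
      ((SmoothOn.mlieBracket hU hZ hX).vdiffAt hU hx)
    simpa using this
  rw [hneg, ← h1 hX hY hZ, ← h1 hZ hX hY, ← h1 hY hZ hX] at hJ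
  rw [← sub_eq_zero] at hJ
  rw [← hJ]
  simp only [curvature]
  abel

lemma curvature_swap (cov : Connection n M) (X Y Z : VField n M) (x : M) :
    curvature cov Y X Z x = -curvature cov X Y Z x := by
  simp only [curvature]
  rw [mlieBracket_swap_apply (V := Y), map_neg]
  abel

/-- The curvature of a metric connection is skew-symmetric. -/
lemma inner_curvature_skew [T2Space M] (he : IsFrame e U) (hU : IsOpen U) (hx : x ∈ U)
    (hs : CovariantDerivative.ContMDiffCovariantDerivative cov ∞)
    (hg : IsMetricConnection g cov)
    (hX : SmoothOn X U) (hY : SmoothOn Y U) (hZ : SmoothOn Z U) (hW : SmoothOn W U) :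
    g.inner x (curvature cov X Y Z x) (W x) + g.inner x (Z x) (curvature cov X Y W x) = 0 := by
  have hsm : ∀ {S T : VField n M}, SmoothOn S U → SmoothOn T U →
      SmoothOn (fun y => cov T y (S y)) U := fun hS hT => hS.covariantDerivative hs hU hT
  have hd : ∀ {S : VField n M}, ∀ y ∈ U,
      mvfderiv (𝓡 n) (fun z => g.inner z (Z z) (W z)) y (S y)
        = g.inner y (cov Z y (S y)) (W y) + g.inner y (Z y) (cov W y (S y)) :=
    fun y hy => hg y Z W (hZ.vdiffAt hU hy) (hW.vdiffAt hU hy) _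
  have hdsm : ∀ {S : VField n M}, SmoothOn S U →
      FunSmoothOn n (fun y => mvfderiv (𝓡 n) (fun z => g.inner z (Z z) (W z)) y (S y)) U :=
    fun hS => (((hsm hS hZ).inner g hW).add (hZ.inner g (hsm hS hW))).congr hd
  have hdd : ∀ {S T : VField n M}, SmoothOn S U → SmoothOn T U →
      mvfderiv (𝓡 n) (fun y => mvfderiv (𝓡 n) (fun z => g.inner z (Z z) (W z)) y (T y)) x (S x)
        = g.inner x (cov (fun y => cov Z y (T y)) x (S x)) (W x)
          + g.inner x (cov Z x (T x)) (cov W x (S x))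
          + (g.inner x (cov Z x (S x)) (cov W x (T x))
          + g.inner x (Z x) (cov (fun y => cov W y (T y)) x (S x))) := by
    intro S T hS hT
    rw [mvfderiv_congr hU hx (hd (S := T)), ← hg x _ _ ((hsm hT hZ).vdiffAt hU hx)
      (hW.vdiffAt hU hx), ← hg x _ _ (hZ.vdiffAt hU hx) ((hsm hT hW).vdiffAt hU hx),
      ← add_apply, ← mvfderiv_add
      (((hsm hT hZ).inner g hW).mdiffAt hU hx) ((hZ.inner g (hsm hT hW)).mdiffAt hU hx)]
    rfl
  have h := mvfderiv_mlieBracket he hU hx hX hY (hZ.inner g hW) (hdsm hX) (hdsm hY)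
  rw [hdd hX hY, hdd hY hX, hg x Z W (hZ.vdiffAt hU hx) (hW.vdiffAt hU hx)] at h
  simp only [curvature, map_sub, sub_apply]
  linarith

/-- The curvature of a complex connection commutes with `J`. -/
lemma curvature_complex [T2Space M] (hJ : IsAlmostHermitian g J) (hU : IsOpen U) (hx : x ∈ U)
    (hs : CovariantDerivative.ContMDiffCovariantDerivative cov ∞)
    (hc : IsComplexConnection J cov)
    (hX : SmoothOn X U) (hY : SmoothOn Y U) (hZ : SmoothOn Z U) :
    curvature cov X Y (fun y => J y (Z y)) x = J x (curvature cov X Y Z x) := by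
  have hsm : ∀ {S T : VField n M}, SmoothOn S U → SmoothOn T U →
      SmoothOn (fun y => cov T y (S y)) U := fun hS hT => hS.covariantDerivative hs hU hT
  have hdd : ∀ {S T : VField n M}, SmoothOn T U →
      cov (fun y => cov (fun z => J z (Z z)) y (T y)) x (S x)
        = J x (cov (fun y => cov Z y (T y)) x (S x)) := by
    intro S T hT
    rw [← hc x _ ((hsm hT hZ).vdiffAt hU hx)]
    rw [cov_congr cov hU hx ((hsm hT (hJ.smoothOn hZ)).vdiffAt hU hx)
      ((hJ.smoothOn (hsm hT hZ)).vdiffAt hU hx)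
      fun y hy => hc y Z (hZ.vdiffAt hU hy) (T y)]
  simp only [curvature]
  rw [hdd hY, hdd hX, hc x Z (hZ.vdiffAt hU hx), map_sub, map_sub]

end Connections

/-! ### Hermitian linear algebra in components -/

section Algebra

variable {ι : Type*} [Fintype ι]

/-- The components, in a basis of a Hermitian vector space, of the metric `G`, its inverse `Gi`,
the complex structure `J` and the inverse `W` of the Kähler form. An upper index comes after the
lower ones. That `W` is inverse to the Kähler form enters as `W = -Gi J`, which is equivalent to it
in view of `J² = -1`. -/
structure IsHermitianData [DecidableEq ι] (G Gi J W : ι → ι → ℝ) : Prop where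
  symm : ∀ i j, G i j = G j i
  symmInv : ∀ i j, Gi i j = Gi j i
  inv : ∀ i j, ∑ k, Gi i k * G k j = if i = j then 1 else 0
  sq : ∀ i j, ∑ k, J i k * J k j = if i = j then -1 else 0
  eq : ∀ i m, W i m = -∑ l, Gi i l * J l m
  skew : ∀ i m, W i m = -W m i

/-- The contraction `Wⁱᵐ Fᵢₘ`. -/
def contr (W F : ι → ι → ℝ) : ℝ := ∑ i, ∑ m, W i m * F i m

lemma contr_swap (W F : ι → ι → ℝ) : contr W F = contr (fun i m => W m i) fun i m => F m i :=
  Finset.sum_comm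

lemma contr_add (W F H : ι → ι → ℝ) :
    contr W (fun i m => F i m + H i m) = contr W F + contr W H := by
  simp [contr, mul_add, Finset.sum_add_distrib]

lemma contr_sub (W F H : ι → ι → ℝ) :
    contr W (fun i m => F i m - H i m) = contr W F - contr W H := by
  simp [contr, mul_sub, Finset.sum_sub_distrib]

lemma contr_smul (W F : ι → ι → ℝ) (c : ℝ) :
    contr W (fun i m => c * F i m) = c * contr W F := by
  simp only [contr, Finset.mul_sum]
  exact Finset.sum_congr rfl fun i _ => Finset.sum_congr rfl fun m _ => by ring

lemma contr_sum {κ : Type*} (s : Finset κ) (W : ι → ι → ℝ) (F : κ → ι → ι → ℝ) :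
    contr W (fun i m => ∑ k ∈ s, F k i m) = ∑ k ∈ s, contr W (F k) := by
  simp only [contr, Finset.mul_sum]
  rw [Finset.sum_comm]
  conv_rhs => rw [Finset.sum_comm]
  conv_lhs => rw [Finset.sum_comm]
  exact Finset.sum_congr rfl fun i _ => Finset.sum_comm

/-- Contraction with a skew `W` only depends on the skew part. -/
lemma contr_congr_skew {W F H : ι → ι → ℝ} (hW : ∀ i m, W i m = -W m i)
    (h : ∀ i m, F i m - F m i = H i m - H m i) : contr W F = contr W H := by
  have key : ∀ F : ι → ι → ℝ, 2 * contr W F = contr W fun i m => F i m - F m i := fun F => by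
    have : contr W (fun i m => F m i) = -contr W F := by
      rw [contr_swap]
      simp only [contr, ← Finset.sum_neg_distrib]
      exact Finset.sum_congr rfl fun i _ => Finset.sum_congr rfl fun m _ => by
        rw [hW m i]; ring
    rw [contr_sub, this]; ring
  have h1 := key F
  have h2 := key H
  simp only [h] at h1
  linarith

variable [DecidableEq ι] {G Gi J W : ι → ι → ℝ}

namespace IsHermitianData

lemma trace_skew (hH : IsHermitianData G Gi J W) {F : ι → ι → ℝ} (hF : ∀ i j, F i j = -F j i) :
    ∑ i, ∑ l, Gi i l * F i l = 0 := by
  have h : ∑ i, ∑ l, Gi i l * F i l = -∑ i, ∑ l, Gi i l * F i l := by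
    conv_lhs => rw [Finset.sum_comm]
    simp only [← Finset.sum_neg_distrib]
    exact Finset.sum_congr rfl fun i _ => Finset.sum_congr rfl fun l _ => by
      rw [hH.symmInv l i, hF l i]; ring
  linarith

/-- Raising an index that has been lowered. -/
lemma raise_lower (hH : IsHermitianData G Gi J W) (A : ι → ℝ) (s : ι) :
    ∑ l, Gi s l * ∑ p, A p * G p l = A s := by
  simp only [Finset.mul_sum]
  rw [Finset.sum_comm]
  have : ∀ p, ∑ l, Gi s l * (A p * G p l) = A p * if s = p then 1 else 0 := fun p => by
    rw [← hH.inv s p, Finset.mul_sum]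
    exact Finset.sum_congr rfl fun l _ => by rw [hH.symm p l]; ring
  simp [this]

/-- `Wⁱᵐ tᵢₘ = 0` for a skew `t` with `t(Jv, w) = t(v, Jw)`. -/
lemma contr_eq_zero (hH : IsHermitianData G Gi J W) {t : ι → ι → ℝ}
    (hskew : ∀ i j, t i j = -t j i) (hJ : ∀ i j, ∑ a, J i a * t a j = ∑ a, J j a * t i a) :
    contr W t = 0 := by
  have h1 : contr W t = -∑ i, ∑ l, Gi i l * ∑ m, J l m * t i m := by
    simp only [contr, hH.eq, neg_mul, Finset.sum_neg_distrib, Finset.sum_mul, Finset.mul_sum]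
    congr 1
    refine Finset.sum_congr rfl fun i _ => ?_
    rw [Finset.sum_comm]
    exact Finset.sum_congr rfl fun l _ => Finset.sum_congr rfl fun m _ => by ring
  have h2 : contr W t = ∑ i, ∑ l, Gi i l * ∑ m, J l m * t i m := by
    rw [h1]
    conv_rhs => rw [Finset.sum_comm]
    simp only [← Finset.sum_neg_distrib]
    refine Finset.sum_congr rfl fun i _ => Finset.sum_congr rfl fun l _ => ?_
    rw [hH.symmInv l i, ← hJ i l, ← mul_neg, ← Finset.sum_neg_distrib]
    congr 1
    exact Finset.sum_congr rfl fun m _ => by rw [hskew m l]; ring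
  linarith

/-- `Wⁱᵐ tᵢₐₘ = -Jₐᵘ tᵤₛˢ` for a `t` that is skew and satisfies `t(Jv, w) = t(v, Jw)` in its
first two arguments. -/
lemma contr_eq_trace (hH : IsHermitianData G Gi J W) {t : ι → ι → ι → ℝ}
    (hskew : ∀ i j k, t i j k = -t j i k)
    (hJ : ∀ i j k, ∑ a, J i a * t a j k = ∑ a, J j a * t i a k) (a : ι) :
    contr W (fun i m => t i a m) = -∑ u, J a u * ∑ s, ∑ l, Gi s l * t u s l := by
  have h0 : ∀ i m, W i m = ∑ l, Gi m l * J l i := fun i m => by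
    rw [hH.skew, hH.eq, neg_neg]
  calc contr W (fun i m => t i a m) = ∑ m, ∑ l, Gi m l * ∑ i, J l i * t i a m := by
        simp only [contr, h0, Finset.sum_mul, Finset.mul_sum]
        rw [Finset.sum_comm]
        refine Finset.sum_congr rfl fun m _ => ?_
        rw [Finset.sum_comm]
        exact Finset.sum_congr rfl fun l _ => Finset.sum_congr rfl fun i _ => by ring
    _ = ∑ m, ∑ l, ∑ u, -(J a u * (Gi l m * t u l m)) := by
        refine Finset.sum_congr rfl fun m _ => Finset.sum_congr rfl fun l _ => ?_
        rw [hJ, Finset.mul_sum]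
        exact Finset.sum_congr rfl fun u _ => by rw [hskew l u m, hH.symmInv m l]; ring
    _ = _ := by
        simp only [Finset.sum_neg_distrib, Finset.mul_sum]
        congr 1
        rw [Finset.sum_comm]
        conv_rhs => rw [Finset.sum_comm]
        refine Finset.sum_congr rfl fun l _ => ?_
        rw [Finset.sum_comm]

/-- The Ricci-type trace of a curvature tensor commuting with `J` is, up to `J`, its contraction
with the inverse of the Kähler form. -/
lemma trace_curvature (hH : IsHermitianData G Gi J W) {R : ι → ι → ι → ι → ℝ}
    (h12 : ∀ i j k l, R i j k l = -R j i k l)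
    (hJ : ∀ i j k l, ∑ a, J k a * R i j a l = -∑ a, J l a * R i j k a) (j k : ι) :
    ∑ i, ∑ l, Gi i l * R i j k l = ∑ a, J k a * contr W fun i m => R j i a m := by
  have h1 : ∀ i l, R i j k l = ∑ a, J k a * ∑ m, J l m * R i j a m := fun i l => by
    have : ∀ a, ∑ m, J l m * R i j a m = -∑ b, J a b * R i j b l := fun a => by
      rw [hJ]; ring
    simp only [this, mul_neg, Finset.sum_neg_distrib, Finset.mul_sum, ← mul_assoc]
    rw [Finset.sum_comm]
    simp only [← Finset.sum_mul, hH.sq]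
    simp
  calc ∑ i, ∑ l, Gi i l * R i j k l
      = ∑ i, ∑ l, ∑ a, ∑ m, J k a * (Gi i l * J l m * R i j a m) := by
        refine Finset.sum_congr rfl fun i _ => Finset.sum_congr rfl fun l _ => ?_
        rw [h1, Finset.mul_sum]
        refine Finset.sum_congr rfl fun a _ => ?_
        simp only [Finset.mul_sum]
        exact Finset.sum_congr rfl fun m _ => by ring
    _ = ∑ a, ∑ i, ∑ m, ∑ l, J k a * (Gi i l * J l m * R i j a m) := by
        conv_rhs => rw [Finset.sum_comm]
        refine Finset.sum_congr rfl fun i _ => ?_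
        rw [Finset.sum_comm]
        exact Finset.sum_congr rfl fun a _ => Finset.sum_comm
    _ = _ := by
        simp only [contr, Finset.mul_sum]
        refine Finset.sum_congr rfl fun a _ => Finset.sum_congr rfl fun i _ =>
          Finset.sum_congr rfl fun m _ => ?_
        rw [h12 j i a m, hH.eq, ← Finset.mul_sum, ← Finset.sum_mul]
        ring

/-- A consequence of the first Bianchi identity with torsion: `2 Wⁱᵐ Rⱼᵢₐₘ` differs from
`Wⁱᵐ Rⱼₐᵢₘ` by contractions of the cyclic sums `S` of the curvature, which vanish for a
torsion-free connection. -/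
lemma contr_curvature (hH : IsHermitianData G Gi J W) {R S : ι → ι → ι → ι → ℝ}
    (h12 : ∀ i j k l, R i j k l = -R j i k l) (h34 : ∀ i j k l, R i j k l = -R i j l k)
    (hS : ∀ i j k l, R i j k l + R j k i l + R k i j l = S i j k l) (j a : ι) :
    2 * contr W (fun i m => R j i a m) = contr W (fun i m => R j a i m)
      + contr W fun i m => S j i a m - (1 / 2) * S i m j a - (1 / 2) * S i m a j := by
  rw [← contr_smul, ← contr_add]
  -- The skew parts in `i` and `m` agree identically, by the symmetries of `R` alone.
  refine contr_congr_skew hH.skew fun i m => ?_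
  simp only [← hS]
  linarith [h12 j i a m, h12 i a j m, h12 a j i m, h12 i m j a, h12 m j i a, h12 j i m a,
    h12 i m a j, h12 m a i j, h12 a i m j, h12 j m a i, h12 m a j i, h12 a j m i, h12 m i j a,
    h12 m i a j, h12 j a i m, h34 j i a m, h34 i a j m, h34 a j i m, h34 i m j a, h34 m j i a,
    h34 j i m a, h34 i m a j, h34 m a i j, h34 a i m j, h34 j m a i, h34 m a j i, h34 a j m i,
    h34 j a i m, h34 j m i a, h34 m i a j]

/-- Evaluation of the torsion terms of `contr_curvature`. Here `th` stands for the components of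
`D - ∇`, `t` for the torsion with its last index lowered and `tu` for the torsion itself, `dt` and
`dth` for their covariant derivatives, and `S` is the cyclic sum in the first Bianchi identity. -/
lemma contr_torsion (hH : IsHermitianData G Gi J W)
    {t tu th : ι → ι → ι → ℝ} {dt dth S : ι → ι → ι → ι → ℝ}
    (htu : ∀ i j l, t i j l = ∑ s, tu i j s * G s l)
    (htus : ∀ i j k, tu i j k = -tu j i k)
    (htuJ : ∀ i j k, ∑ a, J i a * tu a j k = ∑ a, J j a * tu i a k)
    (hthskew : ∀ i j k, th i j k = -th i k j)
    (hth : ∀ i j k, t i j k = th j i k - th i j k)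
    (hdthskew : ∀ l i j k, dth l i j k = -dth l i k j)
    (hdth : ∀ l i j k, dt l i j k = dth l j i k - dth l i j k)
    (hdtJ : ∀ l i j k, ∑ a, J i a * dt l a j k = ∑ a, J j a * dt l i a k)
    (hS : ∀ i j k l, S i j k l = (dt i j k l + ∑ s, tu i j s * t s k l)
      + (dt j k i l + ∑ s, tu j k s * t s i l) + (dt k i j l + ∑ s, tu k i s * t s j l))
    (j a : ι) :
    (1 / 2) * contr W (fun i m => S j i a m - (1 / 2) * S i m j a - (1 / 2) * S i m a j)
      = -(1 / 2) * (∑ u, J a u * ∑ s, ∑ l, Gi s l * dt j u s l)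
        + (1 / 2) * (∑ u, J j u * ∑ s, ∑ l, Gi s l * dt a u s l)
        + contr W (fun b r => dth b j a r)
        + contr W (fun b r => ∑ s, tu r a s * th j b s)
        + contr W (fun b r => ∑ s, tu b j s * th s a r)
        + (1 / 2) * ∑ s, (∑ u, J s u * ∑ p, ∑ l, Gi p l * t u p l) * tu a j s := by
  have hts : ∀ i j k, t i j k = -t j i k := fun i j k => by
    rw [htu, htu, ← Finset.sum_neg_distrib]
    exact Finset.sum_congr rfl fun s _ => by rw [htus]; ring
  have htJ : ∀ i j k, ∑ a, J i a * t a j k = ∑ a, J j a * t i a k := fun i j k => by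
    simp only [htu, Finset.mul_sum, ← mul_assoc]
    rw [Finset.sum_comm]
    conv_rhs => rw [Finset.sum_comm]
    refine Finset.sum_congr rfl fun s _ => ?_
    rw [← Finset.sum_mul, ← Finset.sum_mul, htuJ]
  have hdts : ∀ l i j k, dt l i j k = -dt l j i k := fun l i j k => by
    rw [hdth, hdth]; ring
  have e1 := hH.contr_eq_trace (hdts j) (hdtJ j) a
  have e2 := hH.contr_eq_trace (hdts a) (hdtJ a) j
  have e3 : ∑ s, (∑ u, J s u * ∑ p, ∑ l, Gi p l * t u p l) * tu a j s
      = contr W fun i m => ∑ s, tu a j s * t s i m := by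
    rw [contr_sum]
    refine Finset.sum_congr rfl fun s _ => ?_
    rw [contr_smul]
    have h1 := hH.contr_eq_trace hts htJ s
    have h2 : contr W (fun i m => t s i m) = -contr W fun i m => t i s m := by
      simp only [contr, ← Finset.sum_neg_distrib]
      exact Finset.sum_congr rfl fun i _ => Finset.sum_congr rfl fun m _ => by
        rw [hts s i m]; ring
    rw [h2, h1]; ring
  have z1 : ∀ j a, contr W (fun i m => dt j i m a) = 0 := fun j a =>
    hH.contr_eq_zero (fun i m => hdts j i m a) fun i m => hdtJ j i m a
  have z2 : ∀ j a, contr W (fun i m => ∑ s, tu i m s * t s j a) = 0 := fun j a => by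
    rw [contr_sum]
    refine Finset.sum_eq_zero fun s _ => ?_
    have : contr W (fun i m => tu i m s * t s j a) = t s j a * contr W fun i m => tu i m s := by
      rw [← contr_smul]; simp only [mul_comm]
    rw [this, hH.contr_eq_zero (fun i m => htus i m s) fun i m => htuJ i m s, mul_zero]
  -- The pairing `K` of two values of the torsion, and the composition `Q` of the torsion with
  -- itself, are the quadratic expressions that occur.
  obtain ⟨K, hK⟩ : ∃ K : ι → ι → ι → ι → ℝ, ∀ i j k l, ∑ s, tu i j s * t k l s = K i j k l :=
    ⟨_, fun _ _ _ _ => rfl⟩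
  obtain ⟨Q, hQ⟩ : ∃ Q : ι → ι → ι → ι → ℝ, ∀ i j k l, ∑ s, tu i j s * t s k l = Q i j k l :=
    ⟨_, fun _ _ _ _ => rfl⟩
  have hK12 : ∀ i j k l, K i j k l = -K j i k l := fun i j k l => by
    rw [← hK, ← hK, ← Finset.sum_neg_distrib]
    exact Finset.sum_congr rfl fun s _ => by rw [htus]; ring
  have hKsym : ∀ i j k l, K i j k l = K k l i j := fun i j k l => by
    rw [← hK, ← hK]
    simp only [htu, Finset.mul_sum]
    rw [Finset.sum_comm]
    exact Finset.sum_congr rfl fun s _ => Finset.sum_congr rfl fun p _ => by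
      rw [hH.symm s p]; ring
  have hQ12 : ∀ i j k l, Q i j k l = -Q j i k l := fun i j k l => by
    rw [← hQ, ← hQ, ← Finset.sum_neg_distrib]
    exact Finset.sum_congr rfl fun s _ => by rw [htus]; ring
  -- The contorsion in terms of the torsion.
  have hth2 : ∀ i j k, th i j k = (1 / 2) * (-t i j k + t j k i - t k i j) := fun i j k => by
    rw [hth, hth, hth]
    linarith [hthskew i j k, hthskew j k i, hthskew k i j]
  have q1 : ∀ m a j i, ∑ s, tu m a s * th j i s
      = (1 / 2) * (-K m a j i - Q m a i j - Q m a j i) := fun m a j i => by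
    simp only [← hK, ← hQ, ← Finset.sum_neg_distrib, ← Finset.sum_sub_distrib, Finset.mul_sum]
    exact Finset.sum_congr rfl fun s _ => by rw [hth2, hts i s j]; ring
  have q2 : ∀ i j a m, ∑ s, tu i j s * th s a m
      = (1 / 2) * (-Q i j a m + K i j a m + Q i j m a) := fun i j a m => by
    simp only [← hK, ← hQ, ← Finset.sum_neg_distrib, ← Finset.sum_add_distrib, Finset.mul_sum]
    exact Finset.sum_congr rfl fun s _ => by rw [hth2, hts m s a]; ring
  simp only [hQ] at e3 z2
  -- All terms are now contractions with `W`. Their difference has a vanishing skew part, up to the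
  -- multiples of `z1` and `z2`.
  have f1 : ∑ u, J a u * ∑ s, ∑ l, Gi s l * dt j u s l = -contr W fun i m => dt j i a m := by
    linarith
  have f2 : ∑ u, J j u * ∑ s, ∑ l, Gi s l * dt a u s l = -contr W fun i m => dt a i j m := by
    linarith
  rw [f1, f2, e3]
  simp only [q1, q2, hS, hQ]
  have key : contr W (fun i m => (1 / 2) * (dt j i a m + Q j i a m + (dt i a j m + Q i a j m)
        + (dt a j i m + Q a j i m)
        - (1 / 2) * (dt i m j a + Q i m j a + (dt m j i a + Q m j i a) + (dt j i m a + Q j i m a))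
        - (1 / 2) * (dt i m a j + Q i m a j + (dt m a i j + Q m a i j)
          + (dt a i m j + Q a i m j))))
      = contr W fun i m => (1 / 2) * dt j i a m - (1 / 2) * dt a i j m + dth i j a m
        + (1 / 2) * (-K m a j i - Q m a i j - Q m a j i)
        + (1 / 2) * (-Q i j a m + K i j a m + Q i j m a) + (1 / 2) * Q a j i m
        - (1 / 4) * (Q i m j a + Q i m a j) - (1 / 4) * (dt j i m a + dt a i m j) := by
    refine contr_congr_skew hH.skew fun i m => ?_
    simp only [hdth]
    linarith [hQ12 j i a m, hQ12 j m a i, hQ12 i a j m, hQ12 m a j i, hQ12 m j i a, hQ12 j i m a,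
      hQ12 j m i a, hQ12 m a i j, hQ12 a i m j, hQ12 a m i j, hQ12 i j m a, hKsym m a j i,
      hK12 j i m a, hKsym i j m a, hKsym i j a m, hK12 a m i j, hKsym i a j m, hK12 j m i a,
      hKsym m j i a, hKsym m j a i, hK12 a i m j, hdthskew i j m a, hdthskew i m j a,
      hdthskew i a j m, hdthskew m j i a, hdthskew m i j a, hdthskew m a j i]
  simp only [contr_add, contr_sub, contr_smul] at key ⊢
  have y1 := z1 j a
  have y2 := z1 a j
  have y3 := z2 j a
  have y4 := z2 a j
  linarith

end IsHermitianData

end Algebra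

/-! ### Contorsion, torsion and the Lee form -/

section Components

variable {n : ℕ} {M : Type*} [TopologicalSpace M] [ChartedSpace (Model n) M]
  [IsManifold (𝓡 n) ∞ M] {U : Set M} {x : M} {g : Metric n M}
  {J : EndField n M} {e : Fin n → VField n M} {cov D C : Connection n M}

lemma IsAlmostHermitian.inner_left (hJ : IsAlmostHermitian g J) (v w : TangentSpace (𝓡 n) x) :
    g.inner x (J x v) w = -g.inner x v (J x w) := by
  rw [← hJ.compat x (J x v) w, hJ.sq]
  simp

lemma kahlerForm_skew (hJ : IsAlmostHermitian g J) (v w : TangentSpace (𝓡 n) x) :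
    kahlerForm g J x v w = -kahlerForm g J x w v := by
  rw [kahlerForm, kahlerForm, hJ.inner_left, g.symm]

/-- A linear form evaluated through the components of a vector. -/
lemma map_eq_sum_coeff (he : IsFrame e U) (hx : x ∈ U) (L : TangentSpace (𝓡 n) x →L[ℝ] ℝ)
    (v : TangentSpace (𝓡 n) x) : L v = ∑ s, he.coeff s x v * L (e s x) := by
  conv_lhs => rw [← sum_coeff he hx v]
  simp

lemma inner_eq_sum_coeff (he : IsFrame e U) (hx : x ∈ U) (g : Metric n M)
    (v w : TangentSpace (𝓡 n) x) :
    g.inner x v w = ∑ s, he.coeff s x v * g.inner x (e s x) w := by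
  rw [g.symm, map_eq_sum_coeff he hx (g.inner x w) v]
  simp only [g.symm x w]

lemma omegaLow_eq (he : IsFrame e U) (hx : x ∈ U) (i j : Fin n) :
    omegaLow g J e i j x = ∑ a, JComp he J i a x * gLow g e a j x :=
  inner_eq_sum_coeff he hx g _ _

/-- The components of an almost Hermitian structure in a frame. -/
lemma isHermitianData (hJ : IsAlmostHermitian g J) (he : IsFrame e U) (hx : x ∈ U) :
    IsHermitianData (fun i j => gLow g e i j x) (fun i j => gUp g e i j x)
      (fun i j => JComp he J i j x) (fun i j => omegaUp g J e i j x) ∧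
    ∀ i j, ∑ k, omegaLow g J e i k x * omegaUp g J e k j x = if i = j then 1 else 0 := by
  set G : Matrix (Fin n) (Fin n) ℝ := Matrix.of fun a b => gLow g e a b x with hG
  set Jm : Matrix (Fin n) (Fin n) ℝ := Matrix.of fun a b => JComp he J a b x with hJm
  set Om : Matrix (Fin n) (Fin n) ℝ := Matrix.of fun a b => omegaLow g J e a b x with hOm
  have h1 : Om = Jm * G := by
    ext i j
    simp [hOm, hJm, hG, Matrix.mul_apply, omegaLow_eq he hx]
  have h2 : Jm * Jm = -1 := by
    ext i j
    have h := congrArg (he.coeff j x) (hJ.sq x (e i x))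
    conv_lhs at h => rw [← sum_coeff he hx (J x (e i x))]
    have h3 : he.coeff j x (e i x) = if i = j then 1 else 0 := by
      have := coeff_sum he hx (fun k => if i = k then 1 else 0) j
      simpa using this
    simp only [map_sum, map_smul, smul_eq_mul, map_neg, h3] at h
    simpa [Matrix.mul_apply, hJm, JComp, Matrix.one_apply] using h
  have h3 : G * G⁻¹ = 1 := Matrix.mul_nonsing_inv _
    (isUnit_iff_ne_zero.2 (gLow_det_ne_zero he hx g))
  have h4 : Om * (-(G⁻¹ * Jm)) = 1 := by
    rw [h1, mul_neg, mul_assoc, ← mul_assoc G, h3, one_mul, h2, neg_neg]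
  have h5 : Om⁻¹ = -(G⁻¹ * Jm) := Matrix.inv_eq_right_inv h4
  have h6 : Om.transpose = -Om := by
    ext i j
    simp only [hOm, Matrix.transpose_apply, Matrix.neg_apply, Matrix.of_apply, omegaLow]
    exact kahlerForm_skew hJ _ _
  have h7 : Om⁻¹ = -Om⁻¹.transpose := by
    refine Matrix.inv_eq_right_inv ?_
    have : Om⁻¹ * Om = 1 := by rw [h5]; exact mul_eq_one_comm.1 h4
    rw [mul_neg, ← neg_mul, ← h6, ← Matrix.transpose_mul, this, Matrix.transpose_one]
  refine ⟨⟨fun i j => gLow_symm g e i j x, fun i j => gUp_symm g e i j x,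
    fun i j => sum_gUp_gLow he hx g i j, fun i j => ?_, fun i m => ?_, fun i m => ?_⟩,
    fun i j => ?_⟩
  · have := congrFun (congrFun h2 i) j
    simp only [Matrix.mul_apply, Matrix.neg_apply, Matrix.one_apply] at this
    rw [show (if i = j then (-1 : ℝ) else 0) = -(if i = j then 1 else 0) by split_ifs <;> simp,
      ← this]
    rfl
  · have := congrFun (congrFun h5 i) m
    simp only [Matrix.neg_apply, Matrix.mul_apply] at this
    exact this
  · exact congrFun (congrFun h7 i) m
  · rw [← h5] at h4
    have := congrFun (congrFun h4 i) j
    simp only [Matrix.mul_apply, Matrix.one_apply] at this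
    exact this

lemma sum_connCoeff_gLow (he : IsFrame e U) (hx : x ∈ U) (g : Metric n M)
    (cov : Connection n M) (i j k : Fin n) :
    ∑ l, connCoeff he cov i j l x * gLow g e l k x
      = g.inner x (cov (e j) x (e i x)) (e k x) :=
  (inner_eq_sum_coeff he hx g _ _).symm

lemma thetaLow_eq (he : IsFrame e U) (hx : x ∈ U) (i j k : Fin n) :
    thetaLow he g D C i j k x
      = g.inner x (D (e j) x (e i x)) (e k x) - g.inner x (C (e j) x (e i x)) (e k x) := by
  simp only [thetaLow, thetaUp, sub_mul, Finset.sum_sub_distrib, sum_connCoeff_gLow he hx]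

/-- `∇g = 0` in components. -/
lemma mvfderiv_gLow (he : IsFrame e U) (hU : IsOpen U) (hx : x ∈ U)
    (hg : IsMetricConnection g cov) (i j k : Fin n) :
    mvfderiv (𝓡 n) (gLow g e j k) x (e i x)
      = ∑ s, (connCoeff he cov i j s x * gLow g e s k x
        + connCoeff he cov i k s x * gLow g e j s x) := by
  have h := hg x (e j) (e k) (SmoothOn.vdiffAt (he.contMDiffOn j) hU hx)
    (SmoothOn.vdiffAt (he.contMDiffOn k) hU hx) (e i x)
  rw [Finset.sum_add_distrib, sum_connCoeff_gLow he hx]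
  simp only [gLow_symm g e j]
  rw [sum_connCoeff_gLow he hx, g.symm x (cov (e k) x (e i x))]
  exact h

lemma thetaLow_skew (he : IsFrame e U) (hU : IsOpen U) (hx : x ∈ U)
    (hD : IsMetricConnection g D) (hC : IsMetricConnection g C) (i j k : Fin n) :
    thetaLow he g D C i j k x = -thetaLow he g D C i k j x := by
  have hj := SmoothOn.vdiffAt (he.contMDiffOn j) hU hx
  have hk := SmoothOn.vdiffAt (he.contMDiffOn k) hU hx
  have h1 := hD x (e j) (e k) hj hk (e i x)
  have h2 := hC x (e j) (e k) hj hk (e i x)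
  rw [g.symm x (e j x)] at h1 h2
  rw [thetaLow_eq he hx, thetaLow_eq he hx]
  linarith

/-- `∇J = 0` in components. -/
lemma mvfderiv_JComp (hJ : IsAlmostHermitian g J) (he : IsFrame e U) (hU : IsOpen U) (hx : x ∈ U)
    (hc : IsComplexConnection J cov) (i k l : Fin n) :
    mvfderiv (𝓡 n) (JComp he J k l) x (e i x)
      = ∑ s, (connCoeff he cov i k s x * JComp he J s l x
        - JComp he J k s x * connCoeff he cov i s l x) := by
  have hk : SmoothOn (e k) U := he.contMDiffOn k
  have h1 := coeff_cov he hU hx g cov (hJ.smoothOn hk) i l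
  rw [hc x (e k) (hk.vdiffAt hU hx)] at h1
  have h2 : he.coeff l x (J x (cov (e k) x (e i x)))
      = ∑ s, connCoeff he cov i k s x * JComp he J s l x := by
    conv_lhs => rw [← sum_coeff he hx (cov (e k) x (e i x))]
    simp [connCoeff, JComp]
  rw [h2] at h1
  rw [Finset.sum_sub_distrib, h1]
  exact (add_sub_cancel_right _ _).symm

/-- The components `τᵢⱼᵏ = Θⱼᵢᵏ - Θᵢⱼᵏ` of the torsion of the Chern connection. -/
def tauUp (he : IsFrame e U) (D C : Connection n M) (i j k : Fin n) (x : M) : ℝ :=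
  thetaUp he D C j i k x - thetaUp he D C i j k x

lemma tauUp_skew (he : IsFrame e U) (D C : Connection n M) (i j k : Fin n) (x : M) :
    tauUp he D C i j k x = -tauUp he D C j i k x := by
  simp [tauUp]

/-- The vanishing of `τ^{1,1}` in the form `τ(Jv, w) = τ(v, Jw)`, in components. -/
lemma tauUp_J (hC : IsChern g J C) (hJ : IsAlmostHermitian g J) (hD : D.torsion = 0)
    (he : IsFrame e U) (hU : IsOpen U) (hx : x ∈ U) (i j k : Fin n) :
    ∑ a, JComp he J i a x * tauUp he D C a j k x
      = ∑ a, JComp he J j a x * tauUp he D C i a k x := by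
  have h := hC.torsion11 x (J x (e i x)) (e j x)
  rw [hJ.sq, map_neg, neg_apply, smul_eq_zero, or_iff_right (by norm_num), ← sub_eq_add_neg,
    sub_eq_zero] at h
  have h2 := congrArg (he.coeff k x) h
  conv_lhs at h2 => rw [← sum_coeff he hx (J x (e i x))]
  conv_rhs at h2 => rw [← sum_coeff he hx (J x (e j x))]
  simpa [map_sum, map_smul, sum_apply, coeff_torsion he hU hx hD, tauUp, JComp] using h2

/-- `dω(X, Y, Z)` is the cyclic sum of `ω(τ(X, Y), Z)`, because `∇ω = 0`. -/
lemma psi_eq (hC : IsChern g J C) (hJ : IsAlmostHermitian g J) (hD : D.torsion = 0)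
    (he : IsFrame e U) (hU : IsOpen U) (hx : x ∈ U) (i j k : Fin n) :
    psi g J e i j k x = ∑ s, (tauUp he D C i j s x * omegaLow g J e s k x
      + tauUp he D C j k s x * omegaLow g J e s i x
      + tauUp he D C k i s x * omegaLow g J e s j x) := by
  have hd : ∀ a, VDiffAt (e a) x := fun a => SmoothOn.vdiffAt (he.contMDiffOn a) hU hx
  have h1 : ∀ a b c, mvfderiv (𝓡 n) (fun y => kahlerForm g J y (e b y) (e c y)) x (e a x)
      = kahlerForm g J x (C (e b) x (e a x)) (e c x)
        - kahlerForm g J x (C (e c) x (e a x)) (e b x) := by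
    intro a b c
    have hb : SmoothOn (fun y => J y (e b y)) U := hJ.smoothOn (he.contMDiffOn b)
    have h := hC.metric x _ (e c) (hb.vdiffAt hU hx) (hd c) (e a x)
    rw [hC.complex x (e b) (hd b)] at h
    have h' : kahlerForm g J x (C (e c) x (e a x)) (e b x)
        = -kahlerForm g J x (e b x) (C (e c) x (e a x)) := kahlerForm_skew hJ _ _
    rw [h', sub_neg_eq_add]
    exact h
  have h2 : ∀ a b c, ∑ s, tauUp he D C a b s x * omegaLow g J e s c x
      = kahlerForm g J x (C (e b) x (e a x)) (e c x) - kahlerForm g J x (C (e a) x (e b x)) (e c x)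
        - kahlerForm g J x (mlieBracket (𝓡 n) (e a) (e b) x) (e c x) := by
    intro a b c
    have ht := C.torsion_apply (hd a) (hd b)
    have hlin : ∀ v : TangentSpace (𝓡 n) x, kahlerForm g J x v (e c x)
        = ∑ s, he.coeff s x v * omegaLow g J e s c x := fun v => by
      have := map_eq_sum_coeff he hx ((g.inner x (e c x)) ∘L (J x)) v
      simp only [ContinuousLinearMap.comp_apply, g.symm x (e c x)] at this
      exact this
    rw [hlin, hlin, hlin, ← Finset.sum_sub_distrib, ← Finset.sum_sub_distrib]
    refine Finset.sum_congr rfl fun s _ => ?_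
    rw [← sub_mul, ← sub_mul, ← map_sub, ← map_sub, ← ht, coeff_torsion he hU hx hD]
    rfl
  simp only [Finset.sum_add_distrib, h2, psi, extDeriv2, h1]
  ring

/-- `Θ` is skew in its last two arguments, so the corresponding trace vanishes. -/
lemma sum_thetaUp_eq_zero (hC : IsChern g J C) (hJ : IsAlmostHermitian g J)
    (hD : IsLeviCivita g D) (he : IsFrame e U) (hU : IsOpen U) (hx : x ∈ U) (k : Fin n) :
    ∑ s, thetaUp he D C k s s x = 0 := by
  have hH := (isHermitianData hJ he hx).1
  rw [← hH.trace_skew fun s l => thetaLow_skew he hU hx hD.metric hC.metric k s l]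
  exact Finset.sum_congr rfl fun s _ =>
    (hH.raise_lower (fun p => thetaUp he D C k s p x) s).symm

/-- The Lee form is the trace of `Θ`. -/
lemma lee_eq (hC : IsChern g J C) (hJ : IsAlmostHermitian g J) (hD : IsLeviCivita g D)
    (he : IsFrame e U) (hU : IsOpen U) (hx : x ∈ U) (k : Fin n) :
    lee g J e k x = ∑ s, thetaUp he D C s k s x := by
  obtain ⟨hH, hinv⟩ := isHermitianData hJ he hx
  have hz := sum_thetaUp_eq_zero hC hJ hD he hU hx k
  have hW : ∀ s, ∑ i, ∑ j, omegaUp g J e j i x * tauUp he D C i j s x = 0 := fun s => by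
    have := hH.contr_eq_zero (t := fun i j => tauUp he D C i j s x)
      (fun i j => tauUp_skew he D C i j s x)
      fun i j => tauUp_J hC hJ hD.torsionFree he hU hx i j s
    rw [← neg_eq_zero, ← this, contr]
    simp only [← Finset.sum_neg_distrib]
    exact Finset.sum_congr rfl fun i _ => Finset.sum_congr rfl fun j _ => by
      rw [hH.skew j i]; ring
  have t1 : ∑ i, ∑ j, omegaUp g J e j i x * ∑ s, tauUp he D C i j s x * omegaLow g J e s k x
      = 0 := by
    calc _ = ∑ s, (∑ i, ∑ j, omegaUp g J e j i x * tauUp he D C i j s x)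
            * omegaLow g J e s k x := by
          simp only [Finset.mul_sum, Finset.sum_mul]
          conv_rhs => rw [Finset.sum_comm]
          refine Finset.sum_congr rfl fun i _ => ?_
          rw [Finset.sum_comm]
          exact Finset.sum_congr rfl fun s _ => Finset.sum_congr rfl fun j _ => by ring
      _ = 0 := by simp [hW]
  have t2 : ∑ i, ∑ j, omegaUp g J e j i x * ∑ s, tauUp he D C j k s x * omegaLow g J e s i x
      = ∑ s, tauUp he D C k s s x := by
    calc _ = ∑ s, ∑ j, tauUp he D C k j s x
            * ∑ i, omegaLow g J e s i x * omegaUp g J e i j x := by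
          simp only [Finset.mul_sum]
          rw [Finset.sum_comm]
          conv_rhs => rw [Finset.sum_comm]
          refine Finset.sum_congr rfl fun j _ => ?_
          rw [Finset.sum_comm]
          exact Finset.sum_congr rfl fun s _ => Finset.sum_congr rfl fun i _ => by
            rw [hH.skew j i, tauUp_skew he D C j k]; ring
      _ = _ := by simp [hinv]
  have t3 : ∑ i, ∑ j, omegaUp g J e j i x * ∑ s, tauUp he D C k i s x * omegaLow g J e s j x
      = ∑ s, tauUp he D C k s s x := by
    calc _ = ∑ s, ∑ i, tauUp he D C k i s x
            * ∑ j, omegaLow g J e s j x * omegaUp g J e j i x := by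
          simp only [Finset.mul_sum]
          conv_rhs => rw [Finset.sum_comm]
          refine Finset.sum_congr rfl fun i _ => ?_
          rw [Finset.sum_comm]
          exact Finset.sum_congr rfl fun s _ => Finset.sum_congr rfl fun j _ => by ring
      _ = _ := by simp [hinv]
  simp only [lee, psi_eq hC hJ hD.torsionFree he hU hx, Finset.sum_add_distrib, mul_add, t1, t2,
    t3]
  simp only [tauUp, Finset.sum_sub_distrib, hz]
  ring

end Components

/-! ### Derivatives of products -/

section Derivatives

variable {n : ℕ} {M : Type*} [TopologicalSpace M] [ChartedSpace (Model n) M] {U : Set M} {x : M}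

lemma mvfderiv_sum_mul {ι : Type*} (s : Finset ι) {f h : ι → M → ℝ} (hU : IsOpen U) (hx : x ∈ U)
    (hf : ∀ i, FunSmoothOn n (f i) U) (hh : ∀ i, FunSmoothOn n (h i) U)
    (v : TangentSpace (𝓡 n) x) :
    mvfderiv (𝓡 n) (fun y => ∑ i ∈ s, f i y * h i y) x v
      = ∑ i ∈ s, (mvfderiv (𝓡 n) (f i) x v * h i x + f i x * mvfderiv (𝓡 n) (h i) x v) := by
  rw [mvfderiv_finset_sum s fun i _ => ((hf i).mul (hh i)).mdiffAt hU hx, sum_apply]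
  refine Finset.sum_congr rfl fun i _ => ?_
  have := mvfderiv_mul ((hf i).mdiffAt hU hx) ((hh i).mdiffAt hU hx)
  have h2 := congrArg (fun L : TangentSpace (𝓡 n) x →L[ℝ] ℝ => L v) this
  simp only [add_apply, smul_apply, smul_eq_mul] at h2
  refine Eq.trans h2 ?_
  ring

end Derivatives

/-! ### Covariant derivatives and curvature in components -/

section Components

variable {n : ℕ} {M : Type*} [TopologicalSpace M] [ChartedSpace (Model n) M]
  [IsManifold (𝓡 n) ∞ M] {U : Set M} {x : M} {g : Metric n M}
  {J : EndField n M} {e : Fin n → VField n M} {cov D C : Connection n M}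

/-- `∇ᵢ Bⱼₖˡ` for a tensor with components `Bⱼₖˡ`. -/
def nabla21 (he : IsFrame e U) (cov : Connection n M) (B : Fin n → Fin n → Fin n → M → ℝ)
    (i j k l : Fin n) (x : M) : ℝ :=
  mvfderiv (𝓡 n) (B j k l) x (e i x)
    - ∑ s, (connCoeff he cov i j s x * B s k l x + connCoeff he cov i k s x * B j s l x
      - connCoeff he cov i s l x * B j k s x)

/-- Covariant differentiation commutes with lowering the last index. -/
lemma nabla3_lower (he : IsFrame e U) (hU : IsOpen U) (hx : x ∈ U)
    (hg : IsMetricConnection g cov) {B : Fin n → Fin n → Fin n → M → ℝ}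
    (hB : ∀ j k l, FunSmoothOn n (B j k l) U) (i j k l : Fin n) :
    nabla3 he cov (fun j k l y => ∑ s, B j k s y * gLow g e s l y) i j k l x
      = ∑ s, nabla21 he cov B i j k s x * gLow g e s l x := by
  have hG : ∀ a b, FunSmoothOn n (gLow g e a b) U := fun a b =>
    SmoothOn.inner g (he.contMDiffOn a) (he.contMDiffOn b)
  rw [nabla3, mvfderiv_sum_mul _ hU hx (fun s => hB j k s) (fun s => hG s l)]
  simp only [mvfderiv_gLow he hU hx hg, nabla21, sub_mul, Finset.sum_add_distrib,
    Finset.sum_sub_distrib, add_mul, mul_add, Finset.sum_mul, Finset.mul_sum]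
  have c1 : ∑ s, ∑ p, B j k s x * (connCoeff he cov i l p x * gLow g e s p x)
      = ∑ s, ∑ p, connCoeff he cov i l s x * (B j k p x * gLow g e p s x) := by
    rw [Finset.sum_comm]
    exact Finset.sum_congr rfl fun s _ => Finset.sum_congr rfl fun p _ => by ring
  have c2 : ∑ s, ∑ p, B j k s x * (connCoeff he cov i s p x * gLow g e p l x)
      = ∑ s, ∑ p, connCoeff he cov i p s x * B j k p x * gLow g e s l x := by
    rw [Finset.sum_comm]
    exact Finset.sum_congr rfl fun s _ => Finset.sum_congr rfl fun p _ => by ring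
  have c3 : ∑ s, ∑ p, connCoeff he cov i j s x * (B s k p x * gLow g e p l x)
      = ∑ s, ∑ p, connCoeff he cov i j p x * B p k s x * gLow g e s l x := by
    rw [Finset.sum_comm]
    exact Finset.sum_congr rfl fun s _ => Finset.sum_congr rfl fun p _ => by ring
  have c4 : ∑ s, ∑ p, connCoeff he cov i k s x * (B j s p x * gLow g e p l x)
      = ∑ s, ∑ p, connCoeff he cov i k p x * B j p s x * gLow g e s l x := by
    rw [Finset.sum_comm]
    exact Finset.sum_congr rfl fun s _ => Finset.sum_congr rfl fun p _ => by ring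
  rw [c1, c2, c3, c4]
  ring

lemma nabla3_skew (he : IsFrame e U) (hU : IsOpen U) (hx : x ∈ U) (cov : Connection n M)
    {B : Fin n → Fin n → Fin n → M → ℝ} (hB : ∀ j k l, ∀ y ∈ U, B j k l y = -B j l k y)
    (i j k l : Fin n) : nabla3 he cov B i j k l x = -nabla3 he cov B i j l k x := by
  have h1 : mvfderiv (𝓡 n) (B j k l) x = -mvfderiv (𝓡 n) (B j l k) x := by
    rw [mvfderiv_congr hU hx (hB j k l)]
    exact mvfderiv_neg
  have h2 : ∑ s, (connCoeff he cov i j s x * B s k l x + connCoeff he cov i k s x * B j s l x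
        + connCoeff he cov i l s x * B j k s x)
      = -∑ s, (connCoeff he cov i j s x * B s l k x + connCoeff he cov i l s x * B j s k x
        + connCoeff he cov i k s x * B j l s x) := by
    rw [← Finset.sum_neg_distrib]
    exact Finset.sum_congr rfl fun s _ => by
      rw [hB s k l x hx, hB j s l x hx, hB j k s x hx]; ring
  rw [nabla3, nabla3, h1, h2, neg_apply]
  ring

lemma nabla21_skew (he : IsFrame e U) (hU : IsOpen U) (hx : x ∈ U) (cov : Connection n M)
    {B : Fin n → Fin n → Fin n → M → ℝ} (hB : ∀ j k l, ∀ y ∈ U, B j k l y = -B k j l y)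
    (i j k l : Fin n) : nabla21 he cov B i j k l x = -nabla21 he cov B i k j l x := by
  have h1 : mvfderiv (𝓡 n) (B j k l) x = -mvfderiv (𝓡 n) (B k j l) x := by
    rw [mvfderiv_congr hU hx (hB j k l)]
    exact mvfderiv_neg
  have h2 : ∑ s, (connCoeff he cov i j s x * B s k l x + connCoeff he cov i k s x * B j s l x
        - connCoeff he cov i s l x * B j k s x)
      = -∑ s, (connCoeff he cov i k s x * B s j l x + connCoeff he cov i j s x * B k s l x
        - connCoeff he cov i s l x * B k j s x) := by
    rw [← Finset.sum_neg_distrib]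
    exact Finset.sum_congr rfl fun s _ => by
      rw [hB s k l x hx, hB j s l x hx, hB j k s x hx]; ring
  rw [nabla21, nabla21, h1, h2, neg_apply]
  ring

/-- Covariant differentiation commutes with inserting `J` into the first argument. -/
lemma nabla21_J (hJ : IsAlmostHermitian g J) (he : IsFrame e U) (hU : IsOpen U) (hx : x ∈ U)
    (hc : IsComplexConnection J cov) {B : Fin n → Fin n → Fin n → M → ℝ}
    (hB : ∀ j k l, FunSmoothOn n (B j k l) U) (i j k l : Fin n) :
    nabla21 he cov (fun j k l y => ∑ a, JComp he J j a y * B a k l y) i j k l x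
      = ∑ a, JComp he J j a x * nabla21 he cov B i a k l x := by
  have hJs : ∀ a b, FunSmoothOn n (JComp he J a b) U := fun a b =>
    SmoothOn.coeff he g (hJ.smoothOn (he.contMDiffOn a)) b
  rw [nabla21, mvfderiv_sum_mul _ hU hx (fun s => hJs j s) (fun s => hB s k l)]
  simp only [mvfderiv_JComp hJ he hU hx hc, nabla21, sub_mul, Finset.sum_add_distrib,
    Finset.sum_sub_distrib, mul_add, mul_sub, Finset.sum_mul, Finset.mul_sum]
  have c1 : ∑ s, ∑ p, connCoeff he cov i j p x * JComp he J p s x * B s k l x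
      = ∑ s, ∑ p, connCoeff he cov i j s x * (JComp he J s p x * B p k l x) := by
    rw [Finset.sum_comm]
    exact Finset.sum_congr rfl fun s _ => Finset.sum_congr rfl fun p _ => by ring
  have c2 : ∑ s, ∑ p, JComp he J j p x * connCoeff he cov i p s x * B s k l x
      = ∑ s, ∑ p, JComp he J j s x * (connCoeff he cov i s p x * B p k l x) := by
    rw [Finset.sum_comm]
    exact Finset.sum_congr rfl fun s _ => Finset.sum_congr rfl fun p _ => by ring
  have c3 : ∑ s, ∑ p, connCoeff he cov i k s x * (JComp he J j p x * B p s l x)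
      = ∑ s, ∑ p, JComp he J j s x * (connCoeff he cov i k p x * B s p l x) := by
    rw [Finset.sum_comm]
    exact Finset.sum_congr rfl fun s _ => Finset.sum_congr rfl fun p _ => by ring
  have c4 : ∑ s, ∑ p, connCoeff he cov i s l x * (JComp he J j p x * B p k s x)
      = ∑ s, ∑ p, JComp he J j s x * (connCoeff he cov i p l x * B s k p x) := by
    rw [Finset.sum_comm]
    exact Finset.sum_congr rfl fun s _ => Finset.sum_congr rfl fun p _ => by ring
  rw [c1, c2, c3, c4]
  ring

/-- Covariant differentiation commutes with the trace. -/
lemma nabla1_trace (he : IsFrame e U) (hU : IsOpen U) (hx : x ∈ U) (cov : Connection n M)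
    {B : Fin n → Fin n → Fin n → M → ℝ} (hB : ∀ j k l, FunSmoothOn n (B j k l) U)
    {α : Fin n → M → ℝ} (hα : ∀ k, ∀ y ∈ U, α k y = ∑ s, B s k s y) (i k : Fin n) :
    nabla1 he cov α i k x = ∑ s, nabla21 he cov B i s k s x := by
  rw [nabla1, mvfderiv_congr hU hx (hα k),
    mvfderiv_finset_sum _ fun s _ => (hB s k s).mdiffAt hU hx, sum_apply]
  simp only [hα _ x hx, nabla21, Finset.sum_add_distrib, Finset.sum_sub_distrib, Finset.mul_sum]
  have c1 : ∑ s, ∑ p, connCoeff he cov i s p x * B p k s x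
      = ∑ s, ∑ p, connCoeff he cov i p s x * B s k p x := Finset.sum_comm
  have c2 : ∑ s, ∑ p, connCoeff he cov i k s x * B p s p x
      = ∑ s, ∑ p, connCoeff he cov i k p x * B s p s x := Finset.sum_comm
  rw [c1, c2]
  ring

lemma smooth_thetaUp [T2Space M] (hD : IsLeviCivita g D) (hC : IsChern g J C)
    (he : IsFrame e U) (hU : IsOpen U) (i j k : Fin n) :
    FunSmoothOn n (thetaUp he D C i j k) U :=
  FunSmoothOn.sub (smooth_connCoeff he hU g hD.smooth i j k)
    (smooth_connCoeff he hU g hC.smooth i j k)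

/-- The curvature of `D = ∇ + Θ` in terms of that of `∇`. -/
lemma curvUp_eq_add [T2Space M] (hD : IsLeviCivita g D) (hC : IsChern g J C)
    (he : IsFrame e U) (hU : IsOpen U) (hx : x ∈ U) (i j k l : Fin n) :
    curvUp he D i j k l x = curvUp he C i j k l x
      + nabla21 he C (thetaUp he D C) i j k l x - nabla21 he C (thetaUp he D C) j i k l x
      + ∑ s, (tauUp he D C i j s x * thetaUp he D C s k l x
        + thetaUp he D C j k s x * thetaUp he D C i s l x
        - thetaUp he D C i k s x * thetaUp he D C j s l x) := by
  have hd : ∀ a b c, mvfderiv (𝓡 n) (thetaUp he D C a b c) x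
      = mvfderiv (𝓡 n) (connCoeff he D a b c) x - mvfderiv (𝓡 n) (connCoeff he C a b c) x :=
    fun a b c => mvfderiv_sub ((smooth_connCoeff he hU g hD.smooth a b c).mdiffAt hU hx)
      ((smooth_connCoeff he hU g hC.smooth a b c).mdiffAt hU hx)
  rw [curvUp_eq he hU hx g hD.smooth, curvUp_eq he hU hx g hC.smooth]
  simp only [nabla21, hd, sub_apply, bracketCoeff_eq_of_torsionFree he hU hx hD.torsionFree]
  have hsum : ∑ s, (connCoeff he D j k s x * connCoeff he D i s l x
        - connCoeff he D i k s x * connCoeff he D j s l x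
        - (connCoeff he D i j s x - connCoeff he D j i s x) * connCoeff he D s k l x)
      = ∑ s, (connCoeff he C j k s x * connCoeff he C i s l x
        - connCoeff he C i k s x * connCoeff he C j s l x
        - (connCoeff he D i j s x - connCoeff he D j i s x) * connCoeff he C s k l x)
      - ∑ s, (connCoeff he C i j s x * thetaUp he D C s k l x
          + connCoeff he C i k s x * thetaUp he D C j s l x
          - connCoeff he C i s l x * thetaUp he D C j k s x)
      + ∑ s, (connCoeff he C j i s x * thetaUp he D C s k l x
          + connCoeff he C j k s x * thetaUp he D C i s l x
          - connCoeff he C j s l x * thetaUp he D C i k s x)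
      + ∑ s, (tauUp he D C i j s x * thetaUp he D C s k l x
        + thetaUp he D C j k s x * thetaUp he D C i s l x
        - thetaUp he D C i k s x * thetaUp he D C j s l x) := by
    rw [← Finset.sum_sub_distrib, ← Finset.sum_add_distrib, ← Finset.sum_add_distrib]
    refine Finset.sum_congr rfl fun s _ => ?_
    simp only [tauUp, thetaUp]
    ring
  rw [hsum]
  ring

lemma sum_curvUp_gLow (he : IsFrame e U) (hx : x ∈ U) (g : Metric n M) (cov : Connection n M)
    (i j k l : Fin n) :
    curvLow he g cov i j k l x = g.inner x (curvature cov (e i) (e j) (e k) x) (e l x) :=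
  (inner_eq_sum_coeff he hx g _ _).symm

lemma curvLow_skew_left (he : IsFrame e U) (hx : x ∈ U) (g : Metric n M) (cov : Connection n M)
    (i j k l : Fin n) : curvLow he g cov i j k l x = -curvLow he g cov j i k l x := by
  rw [sum_curvUp_gLow he hx, sum_curvUp_gLow he hx, curvature_swap cov (e j) (e i)]
  simp

lemma curvLow_skew_right [T2Space M] (hC : IsChern g J C) (he : IsFrame e U) (hU : IsOpen U)
    (hx : x ∈ U) (i j k l : Fin n) :
    curvLow he g C i j k l x = -curvLow he g C i j l k x := by
  have h := inner_curvature_skew he hU hx hC.smooth hC.metric (he.contMDiffOn i)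
    (he.contMDiffOn j) (he.contMDiffOn k) (he.contMDiffOn l)
  rw [sum_curvUp_gLow he hx, sum_curvUp_gLow he hx, g.symm x (curvature C (e i) (e j) (e l) x)]
  linarith

/-- `R(X, Y)` is skew with respect to `ω`. Skew-symmetry of `R(X, Y)` moves the field `J eₖ` out of
the curvature, so that only its value at the point matters. -/
lemma curvLow_J [T2Space M] (hJ : IsAlmostHermitian g J) (hC : IsChern g J C) (he : IsFrame e U)
    (hU : IsOpen U) (hx : x ∈ U) (i j k l : Fin n) :
    ∑ a, JComp he J k a x * curvLow he g C i j a l x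
      = -∑ a, JComp he J l a x * curvLow he g C i j k a x := by
  have hi : SmoothOn (e i) U := he.contMDiffOn i
  have hj : SmoothOn (e j) U := he.contMDiffOn j
  have hk : SmoothOn (e k) U := he.contMDiffOn k
  have hl : SmoothOn (e l) U := he.contMDiffOn l
  have h := inner_curvature_skew he hU hx hC.smooth hC.metric hi hj (hJ.smoothOn hk) hl
  rw [curvature_complex hJ hU hx hC.smooth hC.complex hi hj hk, hJ.inner_left,
    inner_eq_sum_coeff he hx g (J x (e k x)), g.symm x (curvature C (e i) (e j) (e k) x),
    inner_eq_sum_coeff he hx g (J x (e l x))] at h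
  have h1 : ∀ a b, g.inner x (e b x) (curvature C (e i) (e j) (e a) x)
      = curvLow he g C i j a b x := fun a b => by
    rw [sum_curvUp_gLow he hx, g.symm]
  simp only [h1] at h
  have h2 : ∑ a, JComp he J k a x * curvLow he g C i j a l x
      = -∑ a, JComp he J k a x * curvLow he g C i j l a x := by
    rw [← Finset.sum_neg_distrib]
    exact Finset.sum_congr rfl fun a _ => by rw [curvLow_skew_right hC he hU hx i j a l]; ring
  simp only [JComp] at h2 ⊢
  linarith

end Components

/-! ### The trace of the Chern curvature -/

section Components

variable {n : ℕ} {M : Type*} [TopologicalSpace M] [T2Space M] [ChartedSpace (Model n) M]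
  [IsManifold (𝓡 n) ∞ M] {U : Set M} {x : M} {g : Metric n M}
  {J : EndField n M} {e : Fin n → VField n M} {cov D C : Connection n M}

lemma nabla21_tauUp (hD : IsLeviCivita g D) (hC : IsChern g J C)
    (he : IsFrame e U) (hU : IsOpen U) (hx : x ∈ U) (l i j k : Fin n) :
    nabla21 he C (tauUp he D C) l i j k x
      = nabla21 he C (thetaUp he D C) l j i k x - nabla21 he C (thetaUp he D C) l i j k x := by
  have hs := fun a b c => (smooth_thetaUp hD hC he hU a b c).mdiffAt hU hx
  have h1 : mvfderiv (𝓡 n) (tauUp he D C i j k) x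
      = mvfderiv (𝓡 n) (thetaUp he D C j i k) x - mvfderiv (𝓡 n) (thetaUp he D C i j k) x :=
    mvfderiv_sub (hs j i k) (hs i j k)
  have h2 : ∑ s, (connCoeff he C l i s x * tauUp he D C s j k x
        + connCoeff he C l j s x * tauUp he D C i s k x
        - connCoeff he C l s k x * tauUp he D C i j s x)
      = ∑ s, (connCoeff he C l j s x * thetaUp he D C s i k x
          + connCoeff he C l i s x * thetaUp he D C j s k x
          - connCoeff he C l s k x * thetaUp he D C j i s x)
        - ∑ s, (connCoeff he C l i s x * thetaUp he D C s j k x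
          + connCoeff he C l j s x * thetaUp he D C i s k x
          - connCoeff he C l s k x * thetaUp he D C i j s x) := by
    rw [← Finset.sum_sub_distrib]
    exact Finset.sum_congr rfl fun s _ => by simp only [tauUp]; ring
  rw [nabla21, h2, h1, sub_apply, nabla21, nabla21]
  ring

lemma smooth_tauUp (hD : IsLeviCivita g D) (hC : IsChern g J C)
    (he : IsFrame e U) (hU : IsOpen U) (i j k : Fin n) :
    FunSmoothOn n (tauUp he D C i j k) U :=
  (smooth_thetaUp hD hC he hU j i k).sub (smooth_thetaUp hD hC he hU i j k)

/-- The covariant derivative of the torsion inherits the symmetry `τ(Jv, w) = τ(v, Jw)`. -/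
lemma nabla21_tauUp_J (hJ : IsAlmostHermitian g J) (hD : IsLeviCivita g D) (hC : IsChern g J C)
    (he : IsFrame e U) (hU : IsOpen U) (hx : x ∈ U) (l i j k : Fin n) :
    ∑ a, JComp he J i a x * nabla21 he C (tauUp he D C) l a j k x
      = ∑ a, JComp he J j a x * nabla21 he C (tauUp he D C) l i a k x := by
  have hs := smooth_tauUp hD hC he hU
  have h1 := nabla21_J hJ he hU hx hC.complex hs l
  rw [← h1, nabla21_skew he hU hx C (fun i j k y hy => ?_), h1, ← Finset.sum_neg_distrib]
  · refine Finset.sum_congr rfl fun a _ => ?_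
    rw [nabla21_skew he hU hx C (fun i j k y _ => tauUp_skew he D C i j k y) l i a k]
    ring
  · rw [tauUp_J hC hJ hD.torsionFree he hU hy, ← Finset.sum_neg_distrib]
    exact Finset.sum_congr rfl fun a _ => by rw [tauUp_skew he D C i a]; ring

/-- The first Bianchi identity of the Chern connection, whose right side is the cyclic sum of
`∇τ + τ(τ(·, ·), ·)`. It is the Bianchi identity of `D` rewritten through `D = ∇ + Θ`. -/
lemma bianchi_chern (hD : IsLeviCivita g D) (hC : IsChern g J C)
    (he : IsFrame e U) (hU : IsOpen U) (hx : x ∈ U) (i j k l : Fin n) :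
    curvUp he C i j k l x + curvUp he C j k i l x + curvUp he C k i j l x
      = (nabla21 he C (tauUp he D C) i j k l x
          + ∑ s, tauUp he D C i j s x * tauUp he D C s k l x)
        + (nabla21 he C (tauUp he D C) j k i l x
          + ∑ s, tauUp he D C j k s x * tauUp he D C s i l x)
        + (nabla21 he C (tauUp he D C) k i j l x
          + ∑ s, tauUp he D C k i s x * tauUp he D C s j l x) := by
  have h0 := congrArg (he.coeff l x) (bianchi_of_torsionFree hU hx hD.smooth hD.torsionFree
    (he.contMDiffOn i) (he.contMDiffOn j) (he.contMDiffOn k))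
  simp only [map_add, map_zero] at h0
  have h1 : curvUp he D i j k l x + curvUp he D j k i l x + curvUp he D k i j l x = 0 := h0
  simp only [curvUp_eq_add hD hC he hU hx] at h1
  have h2 : (∑ s, (tauUp he D C i j s x * thetaUp he D C s k l x
        + thetaUp he D C j k s x * thetaUp he D C i s l x
        - thetaUp he D C i k s x * thetaUp he D C j s l x))
      + (∑ s, (tauUp he D C j k s x * thetaUp he D C s i l x
        + thetaUp he D C k i s x * thetaUp he D C j s l x
        - thetaUp he D C j i s x * thetaUp he D C k s l x))
      + (∑ s, (tauUp he D C k i s x * thetaUp he D C s j l x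
        + thetaUp he D C i j s x * thetaUp he D C k s l x
        - thetaUp he D C k j s x * thetaUp he D C i s l x))
      = -((∑ s, tauUp he D C i j s x * tauUp he D C s k l x)
        + (∑ s, tauUp he D C j k s x * tauUp he D C s i l x)
        + ∑ s, tauUp he D C k i s x * tauUp he D C s j l x) := by
    simp only [← Finset.sum_add_distrib, ← Finset.sum_neg_distrib]
    exact Finset.sum_congr rfl fun s _ => by simp only [tauUp]; ring
  simp only [nabla21_tauUp hD hC he hU hx]
  linarith

lemma nabla3_thetaLow (hD : IsLeviCivita g D) (hC : IsChern g J C)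
    (he : IsFrame e U) (hU : IsOpen U) (hx : x ∈ U) (i j k l : Fin n) :
    nabla3 he C (thetaLow he g D C) i j k l x
      = ∑ s, nabla21 he C (thetaUp he D C) i j k s x * gLow g e s l x :=
  nabla3_lower he hU hx hC.metric (smooth_thetaUp hD hC he hU) i j k l

/-- `Ωᵢⱼₖⁱ`, the part of the Ricci tensor of `D` coming from the curvature of the Chern connection,
in terms of the Chern-Ricci form and the torsion. -/
lemma trace_curvUp_chern (hJ : IsAlmostHermitian g J) (hD : IsLeviCivita g D) (hC : IsChern g J C)
    (he : IsFrame e U) (hU : IsOpen U) (hx : x ∈ U) (j k : Fin n) :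
    ∑ i, curvUp he C i j k i x
      = (1 / 2 : ℝ) * (∑ a, JComp he J k a x * chernRicci he g J C j a x)
        + (1 / 2 : ℝ) * nabla1 he C (lee g J e) j k x
        + (1 / 2 : ℝ) *
          (∑ a, JComp he J k a x * ∑ u, JComp he J j u x * nabla1 he C (lee g J e) a u x)
        + (∑ a, JComp he J k a x * ∑ b, ∑ r, omegaUp g J e b r x
            * nabla3 he C (thetaLow he g D C) b j a r x)
        + (∑ a, JComp he J k a x * ∑ b, ∑ r, omegaUp g J e b r x
            * ∑ s, tauUp he D C r a s x * thetaLow he g D C j b s x)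
        + (∑ a, JComp he J k a x * ∑ b, ∑ r, omegaUp g J e b r x
            * ∑ s, tauUp he D C b j s x * thetaLow he g D C s a r x)
        + (1 / 2 : ℝ) * (∑ a, JComp he J k a x *
            ∑ s, (∑ p, JComp he J s p x * lee g J e p x) * tauUp he D C a j s x) := by
  have hH := (isHermitianData hJ he hx).1
  have hTh := thetaLow_skew he hU hx hD.metric hC.metric
  have hdTh : ∀ l i j k, nabla3 he C (thetaLow he g D C) l i j k x
      = -nabla3 he C (thetaLow he g D C) l i k j x :=
    nabla3_skew he hU hx C fun i j k y hy => thetaLow_skew he hU hy hD.metric hC.metric i j k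
  have hv : ∀ u, ∑ s, ∑ l, gUp g e s l x * (∑ p, tauUp he D C u s p x * gLow g e p l x)
      = lee g J e u x := fun u => by
    have h1 : ∀ s, ∑ l, gUp g e s l x * (∑ p, tauUp he D C u s p x * gLow g e p l x)
        = tauUp he D C u s s x := fun s => hH.raise_lower (fun p => tauUp he D C u s p x) s
    simp only [h1]
    simp only [tauUp, Finset.sum_sub_distrib, sum_thetaUp_eq_zero hC hJ hD he hU hx,
      lee_eq hC hJ hD he hU hx, sub_zero]
  have hdv : ∀ j u, ∑ s, ∑ l, gUp g e s l x
      * (∑ p, nabla21 he C (tauUp he D C) j u s p x * gLow g e p l x)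
      = nabla1 he C (lee g J e) j u x := fun j u => by
    have h1 : ∀ s, ∑ l, gUp g e s l x
        * (∑ p, nabla21 he C (tauUp he D C) j u s p x * gLow g e p l x)
        = nabla21 he C (tauUp he D C) j u s s x := fun s =>
      hH.raise_lower (fun p => nabla21 he C (tauUp he D C) j u s p x) s
    have h2 : ∑ s, nabla21 he C (thetaUp he D C) j u s s x = 0 := by
      rw [← hH.trace_skew fun s l => hdTh j u s l]
      refine Finset.sum_congr rfl fun s _ => ?_
      simp only [nabla3_thetaLow hD hC he hU hx]
      exact (hH.raise_lower (fun p => nabla21 he C (thetaUp he D C) j u s p x) s).symm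
    simp only [h1]
    simp only [nabla21_tauUp hD hC he hU hx, Finset.sum_sub_distrib, h2, sub_zero]
    exact (nabla1_trace he hU hx C (smooth_thetaUp hD hC he hU)
      (fun k y hy => lee_eq hC hJ hD he hU hy k) j u).symm
  -- The cyclic sum in the Bianchi identity, with the last index lowered. Only the equation `hS` is
  -- needed, and an abstract `S` keeps the terms small.
  obtain ⟨S, hS⟩ : ∃ S : Fin n → Fin n → Fin n → Fin n → ℝ, ∀ i j k l, S i j k l
      = (∑ p, nabla21 he C (tauUp he D C) i j k p x * gLow g e p l x
        + ∑ s, tauUp he D C i j s x * ∑ p, tauUp he D C s k p x * gLow g e p l x)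
      + (∑ p, nabla21 he C (tauUp he D C) j k i p x * gLow g e p l x
        + ∑ s, tauUp he D C j k s x * ∑ p, tauUp he D C s i p x * gLow g e p l x)
      + (∑ p, nabla21 he C (tauUp he D C) k i j p x * gLow g e p l x
        + ∑ s, tauUp he D C k i s x * ∑ p, tauUp he D C s j p x * gLow g e p l x) :=
    ⟨_, fun _ _ _ _ => rfl⟩
  have hB : ∀ i j k l, curvLow he g C i j k l x + curvLow he g C j k i l x
      + curvLow he g C k i j l x = S i j k l := fun i j k l => by
    have hq : ∀ i j k, ∑ s, tauUp he D C i j s x * ∑ p, tauUp he D C s k p x * gLow g e p l x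
        = ∑ p, (∑ s, tauUp he D C i j s x * tauUp he D C s k p x) * gLow g e p l x := by
      intro i j k
      simp only [Finset.mul_sum, Finset.sum_mul]
      rw [Finset.sum_comm]
      exact Finset.sum_congr rfl fun p _ => Finset.sum_congr rfl fun s _ => by ring
    simp only [hS, curvLow, hq, ← Finset.sum_add_distrib, ← add_mul]
    exact Finset.sum_congr rfl fun p _ => by rw [bianchi_chern hD hC he hU hx i j k p]
  have h1 : ∑ i, curvUp he C i j k i x
      = ∑ i, ∑ l, gUp g e i l x * curvLow he g C i j k l x :=
    Finset.sum_congr rfl fun i _ => (hH.raise_lower (fun p => curvUp he C i j k p x) i).symm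
  have h2 := hH.trace_curvature (R := fun i j k l => curvLow he g C i j k l x)
    (curvLow_skew_left he hx g C) (curvLow_J hJ hC he hU hx) j k
  have h3 := fun a => hH.contr_curvature (R := fun i j k l => curvLow he g C i j k l x)
    (curvLow_skew_left he hx g C) (curvLow_skew_right hC he hU hx) hB j a
  have h4 := fun a => hH.contr_torsion
    (t := fun i j k => ∑ p, tauUp he D C i j p x * gLow g e p k x)
    (tu := fun i j k => tauUp he D C i j k x)
    (th := fun i j k => thetaLow he g D C i j k x)
    (dt := fun l i j k => ∑ p, nabla21 he C (tauUp he D C) l i j p x * gLow g e p k x)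
    (dth := fun l i j k => nabla3 he C (thetaLow he g D C) l i j k x)
    (fun _ _ _ => rfl) (fun i j k => tauUp_skew he D C i j k x)
    (fun i j k => tauUp_J hC hJ hD.torsionFree he hU hx i j k) hTh
    (fun i j k => by simp only [tauUp, thetaLow, sub_mul, Finset.sum_sub_distrib])
    hdTh
    (fun l i j k => by
      simp only [nabla21_tauUp hD hC he hU hx, nabla3_thetaLow hD hC he hU hx, sub_mul,
        Finset.sum_sub_distrib])
    (fun l i j k => by
      simp only [Finset.mul_sum, ← mul_assoc]
      rw [Finset.sum_comm]
      conv_rhs => rw [Finset.sum_comm]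
      refine Finset.sum_congr rfl fun s _ => ?_
      rw [← Finset.sum_mul, ← Finset.sum_mul, nabla21_tauUp_J hJ hD hC he hU hx])
    hS j a
  simp only [hv, hdv] at h4
  have h5 : ∀ a, contr (fun i j => omegaUp g J e i j x) (fun i m => curvLow he g C j i a m x)
      = (1 / 2) * chernRicci he g J C j a x
        + (-(1 / 2) * (∑ u, JComp he J a u x * nabla1 he C (lee g J e) j u x)
        + (1 / 2) * (∑ u, JComp he J j u x * nabla1 he C (lee g J e) a u x)
        + (∑ b, ∑ r, omegaUp g J e b r x * nabla3 he C (thetaLow he g D C) b j a r x)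
        + (∑ b, ∑ r, omegaUp g J e b r x
            * ∑ s, tauUp he D C r a s x * thetaLow he g D C j b s x)
        + (∑ b, ∑ r, omegaUp g J e b r x
            * ∑ s, tauUp he D C b j s x * thetaLow he g D C s a r x)
        + (1 / 2) * ∑ s, (∑ p, JComp he J s p x * lee g J e p x) * tauUp he D C a j s x) :=
      fun a => by
    have h6 : contr (fun i j => omegaUp g J e i j x) (fun i m => curvLow he g C j a i m x)
      = chernRicci he g J C j a x := rfl
    have h7 := h3 a
    have h8 := h4 a
    rw [h6] at h7
    simp only [contr] at h7 h8 ⊢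
    linarith
  have h9 : ∑ a, JComp he J k a x * ∑ u, JComp he J a u x * nabla1 he C (lee g J e) j u x
      = -nabla1 he C (lee g J e) j k x := by
    simp only [Finset.mul_sum, ← mul_assoc]
    rw [Finset.sum_comm]
    simp only [← Finset.sum_mul, hH.sq]
    simp
  rw [h1, h2]
  simp only [h5]
  have h10 : (1 / 2 : ℝ) * nabla1 he C (lee g J e) j k x
      = -(1 / 2) * ∑ a, JComp he J k a x
        * ∑ u, JComp he J a u x * nabla1 he C (lee g J e) j u x := by
    rw [h9]; ring
  rw [h10, Finset.mul_sum Finset.univ _ (1 / 2 : ℝ), Finset.mul_sum Finset.univ _ (-(1 / 2) : ℝ),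
    Finset.mul_sum Finset.univ _ (1 / 2 : ℝ), Finset.mul_sum Finset.univ _ (1 / 2 : ℝ)]
  simp only [← Finset.sum_add_distrib]
  exact Finset.sum_congr rfl fun a _ => by ring

end Components

end AlmostHermitianGeometry

end

theorem mainTheorem2 {n : ℕ} {M : Type*} [TopologicalSpace M] [T2Space M]
    [ChartedSpace (Model n) M] [IsManifold (𝓡 n) ∞ M]
    (g : Metric n M) (J : EndField n M) (hJ : IsAlmostHermitian g J)
    (D : Connection n M) (hD : IsLeviCivita g D)
    (C : Connection n M) (hC : IsChern g J C)
    (U : Set M) (hU : IsOpen U) (e : Fin n → VField n M) (he : IsFrame e U)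
    (x : M) (hx : x ∈ U) (j k : Fin n) :
    ricci he D j k x
      = (1 / 2 : ℝ) * (∑ a, JComp he J k a x * chernRicci he g J C j a x)
        - (1 / 2 : ℝ) * nabla1 he C (lee g J e) j k x
        + (1 / 2 : ℝ) *
          (∑ a, ∑ u, JComp he J k a x * JComp he J j u x * nabla1 he C (lee g J e) a u x)
        + (∑ i, ∑ l, gUp g e i l x * nabla3 he C (thetaLow he g D C) i j k l x)
        + (∑ a, ∑ b, ∑ r, JComp he J k a x * omegaUp g J e b r x
            * nabla3 he C (thetaLow he g D C) b j a r x)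
        + (∑ a, ∑ b, ∑ r, ∑ s, JComp he J k a x * omegaUp g J e b r x
            * (thetaUp he D C a r s x - thetaUp he D C r a s x) * thetaLow he g D C j b s x)
        + (∑ a, ∑ b, ∑ r, ∑ s, JComp he J k a x * omegaUp g J e b r x
            * (thetaUp he D C j b s x - thetaUp he D C b j s x) * thetaLow he g D C s a r x)
        + (1 / 2 : ℝ) * (∑ a, ∑ s, ∑ p, JComp he J k a x * JComp he J s p x * lee g J e p x
            * (thetaUp he D C j a s x - thetaUp he D C a j s x))
        + (∑ s, lee g J e s x * thetaUp he D C j k s x)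
        - (∑ i, ∑ s, thetaUp he D C i j s x * thetaUp he D C s k i x) := by
  have hH := (isHermitianData hJ he hx).1
  have h1 : ∑ i, nabla21 he C (thetaUp he D C) i j k i x
      = ∑ i, ∑ l, gUp g e i l x * nabla3 he C (thetaLow he g D C) i j k l x := by
    simp only [nabla3_thetaLow hD hC he hU hx]
    exact Finset.sum_congr rfl fun i _ =>
      (hH.raise_lower (fun p => nabla21 he C (thetaUp he D C) i j k p x) i).symm
  have h2 := nabla1_trace he hU hx C (smooth_thetaUp hD hC he hU)
    (fun k y hy => lee_eq hC hJ hD he hU hy k) j k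
  have h3 : ∑ i, ∑ s, thetaUp he D C j k s x * thetaUp he D C i s i x
      = ∑ s, lee g J e s x * thetaUp he D C j k s x := by
    rw [Finset.sum_comm]
    refine Finset.sum_congr rfl fun s _ => ?_
    rw [lee_eq hC hJ hD he hU hx, Finset.sum_mul]
    exact Finset.sum_congr rfl fun i _ => mul_comm _ _
  -- The quadratic terms that contain no factor `ϑ`.
  have h4 : ∑ i, ∑ s, (tauUp he D C i j s x * thetaUp he D C s k i x
        - thetaUp he D C i k s x * thetaUp he D C j s i x)
      = -∑ i, ∑ s, thetaUp he D C i j s x * thetaUp he D C s k i x := by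
    have : ∑ i, ∑ s, thetaUp he D C i k s x * thetaUp he D C j s i x
        = ∑ i, ∑ s, thetaUp he D C j i s x * thetaUp he D C s k i x := by
      rw [Finset.sum_comm]
      exact Finset.sum_congr rfl fun i _ => Finset.sum_congr rfl fun s _ => mul_comm _ _
    simp only [Finset.sum_sub_distrib, this, tauUp, sub_mul]
    ring
  have h5 : ricci he D j k x = ∑ i, curvUp he C i j k i x
      + ∑ i, nabla21 he C (thetaUp he D C) i j k i x
      - ∑ i, nabla21 he C (thetaUp he D C) j i k i x
      + ∑ i, ∑ s, thetaUp he D C j k s x * thetaUp he D C i s i x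
      + ∑ i, ∑ s, (tauUp he D C i j s x * thetaUp he D C s k i x
        - thetaUp he D C i k s x * thetaUp he D C j s i x) := by
    simp only [ricci, curvUp_eq_add hD hC he hU hx, Finset.sum_add_distrib,
      Finset.sum_sub_distrib]
    ring
  rw [h5, h1, ← h2, h3, h4, trace_curvUp_chern hJ hD hC he hU hx]
  simp only [Finset.mul_sum, Finset.sum_mul, tauUp, mul_assoc]
  ring
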